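/- Let $G$ be a (Hausdorff, second countable) Lie group and $N,H\le G$ closed subgroups with $N$ normal and abelian such that $G=N\ltimes H$, i.e. $N\times H\to G$, $(n,h)\mapsto nh$, is a diffeomorphism. Let $\nu:N\to\mathbb T$ be a (smooth) unitary character, let $G_\nu=\{x\in G:\nu(x^{-1}nx)=\nu(n)\ \forall n\in N\}$ be its isotropy group and $H_\nu=H\cap G_\nu$ the little group, and give $H/H_\nu$ its quotient manifold structure. Let $\sigma$ be a unitary representation of $H_\nu$ on a finite-dimensional Hilbert space $(\mathcal H_\sigma,\langle\cdot,\cdot\rangle_\sigma)$ that extends to a smooth representation $\Phi:H\to GL(\mathcal H_\sigma)$, let $L:H/H_\nu\to H$ be a smooth global section of $H\to H/H_\nu$, and let $\mu$ be an $H$-invariant Borel measure on $H/H_\nu$. Let $\nu\sigma:G_\nu\to U(\mathcal H_\sigma)$ be the representation $\nu\sigma(nh)=\nu(n)\sigma(h)$ ($n\in N$, $h\in H_\nu$), and put $W_L(x,yH_\nu)=L(xyH_\nu)^{-1}\,x\,L(yH_\nu)\in H_\nu$ for $x,y\in H$. Let $G$ act on $H/H_\nu$ by $l_{nh}(yH_\nu)=hyH_\nu$.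 On the product bundle $H/H_\nu\times\mathcal H_\sigma\to H/H_\nu$ consider two structures: * the perception bundle $E_\sigma$, with metric $h\big((xH_\nu,v),(xH_\nu,w)\big)=\langle v,\Phi(x)^{\dagger-1}\Phi(x)^{-1}w\rangle_\sigma$ and action $\lambda(nh)(yH_\nu,v)=\big(hyH_\nu,\ \nu((hy)^{-1}nhy)\,\Phi(h)v\big)$; * the boosting bundle $E_{L,\sigma}$, with metric $h_L\big((xH_\nu,v),(xH_\nu,w)\big)=\langle v,w\rangle_\sigma$ and action $\lambda_L(nh)(yH_\nu,v)=\big(hyH_\nu,\ \nu((hy)^{-1}nhy)\,\sigma(W_L(h,yH_\nu))v\big)$. Then: 1. Both are smooth Hermitian $G$-bundles over $H/H_\nu$: the metrics are well-defined smooth Hermitian metrics, and $\lambda,\lambda_L$ are smooth $G$-actions covering $l$ by isometric bundle isomorphisms. 2. The map $\alpha:E_\sigma\to E_{L,\sigma}$, $(xH_\nu,v)\mapsto\big(xH_\nu,\Phi(L(xH_\nu)^{-1})v\big)$, is a Hermitian $G$-bundle isomorphism: a diffeomorphism over $H/H_\nu$ that is fibrewise linear, isometric and $G$-equivariant. 3.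 Let $U(s)\phi=\lambda(s)\circ\phi\circ l_s^{-1}$ and $U_L(s)\psi=\lambda_L(s)\circ\psi\circ l_s^{-1}$ on the Hilbert spaces $L^2(H/H_\nu,E_\sigma;\mu,h)$ and $L^2(H/H_\nu,E_{L,\sigma};\mu,h_L)$ of square-integrable Borel sections modulo null sections. Let $\mathrm{Ind}_{G_\nu}^G\nu\sigma$ be the induced representation $[\mathrm{Ind}(x)f](y)=f(x^{-1}y)$ on the Hilbert space of Borel functions $f:G\to\mathcal H_\sigma$ with $f(gk)=\nu\sigma(k)^{-1}f(g)$ for $k\in G_\nu$ and $\int_{G/G_\nu}\|f\|_\sigma^2\,d\mu<\infty$, modulo null functions, where $\mu$ is transported by the bijection $H/H_\nu\to G/G_\nu$, $hH_\nu\mapsto hG_\nu$. These are unitary representations of $G$ on Hilbert spaces (strongly continuous when $\mu$ is a Radon measure), and $$\mathrm{Ind}_{G_\nu}^G\nu\sigma\;\cong\;U\;\cong\;U_L$$ (unitary equivalence); $\phi\mapsto\alpha\circ\phi$ is a unitary equivalence of $U$ with $U_L$. 4. $f\otimes v\mapsto f(\cdot)v$ induces a unitary isomorphism $L^2(H/H_\nu;\mu)\otimes\mathcal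 H_\sigma\cong L^2(H/H_\nu,E_{L,\sigma};\mu,h_L)$. -/

import Mathlib

open MeasureTheory Manifold
open scoped ContDiff ComplexConjugate TensorProduct

noncomputable section

/-! ### Unitary representations on the Hausdorff quotient of a pre-Hilbert space -/

section Generic

/-- The positive semidefinite sesquilinear form `⟨f, g⟩ = ∫ B(f, g) dμ` obtained by integrating a
pointwise positive semidefinite Hermitian form `B`. -/
@[reducible]
def integralCore {S M : Type*} [AddCommGroup S] [Module ℂ S] [MeasurableSpace M] (μ : Measure M)
    (B : S → S → M → ℂ) (hint : ∀ f g, Integrable (B f g) μ)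
    (hsymm : ∀ f g m, conj (B g f m) = B f g m) (hnn : ∀ f m, 0 ≤ (B f f m).re)
    (hadd : ∀ f g k m, B (f + g) k m = B f k m + B g k m)
    (hsmul : ∀ (c : ℂ) f g m, B (c • f) g m = conj c * B f g m) :
    PreInnerProductSpace.Core ℂ S where
  inner f g := ∫ m, B f g m ∂μ
  conj_inner_symm f g := by
    rw [← integral_conj]
    exact integral_congr_ae (Filter.Eventually.of_forall fun m => hsymm f g m)
  re_inner_nonneg f := by
    rw [← integral_re (hint f f)]
    exact integral_nonneg fun m => hnn f m
  add_left f g k := by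
    rw [← integral_add (hint f k) (hint g k)]
    exact integral_congr_ae (Filter.Eventually.of_forall fun m => hadd f g k m)
  smul_left f g c := by
    rw [← integral_const_mul]
    exact integral_congr_ae (Filter.Eventually.of_forall fun m => hsmul c f g m)

variable {G X Y : Type*} [Group G]

/-- A linear isometric action on a pre-Hilbert space `X` descends to a unitary representation on
the associated separated space, that is, on `X` modulo the vectors of norm zero. -/
def quotRep [SeminormedAddCommGroup X] [InnerProductSpace ℂ X] (T : G →* Module.End ℂ X)
    (hT : ∀ s f, ‖T s f‖ = ‖f‖) :
    G →* (SeparationQuotient X ≃ₗᵢ[ℂ] SeparationQuotient X) :=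
  let T' (s : G) : X →L[ℂ] X := (⟨T s, hT s⟩ : X →ₗᵢ[ℂ] X).toContinuousLinearMap
  let q (s : G) : SeparationQuotient X →ₗ[ℂ] SeparationQuotient X :=
    (SeparationQuotient.liftCLM ((SeparationQuotient.mkCLM ℂ X).comp (T' s)) fun a b hab => by
      have : Inseparable (T' s a) (T' s b) := hab.map (T' s).continuous
      exact SeparationQuotient.mk_eq_mk.2 this).toLinearMap
  have hq (s : G) (f : X) : q s (SeparationQuotient.mk f) = SeparationQuotient.mk (T s f) := rfl
  have hmul (s t : G) (f : SeparationQuotient X) : q (s * t) f = q s (q t f) := by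
    obtain ⟨f, rfl⟩ := SeparationQuotient.surjective_mk f
    simp [hq]
  have hone (f : SeparationQuotient X) : q 1 f = f := by
    obtain ⟨f, rfl⟩ := SeparationQuotient.surjective_mk f
    simp [hq]
  { toFun := fun s =>
      { toLinearEquiv := LinearEquiv.ofLinearMap (q s) (q s⁻¹)
          (LinearMap.ext fun f => by
            simp only [LinearMap.comp_apply, ← hmul, mul_inv_cancel, hone, LinearMap.id_apply])
          (LinearMap.ext fun f => by
            simp only [LinearMap.comp_apply, ← hmul, inv_mul_cancel, hone, LinearMap.id_apply])
        norm_map' := fun f => by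
          obtain ⟨f, rfl⟩ := SeparationQuotient.surjective_mk f
          change ‖q s (SeparationQuotient.mk f)‖ = _
          rw [hq, SeparationQuotient.norm_mk, SeparationQuotient.norm_mk, hT] }
    map_one' := LinearIsometryEquiv.ext fun f => hone f
    map_mul' := fun s t => LinearIsometryEquiv.ext fun f => hmul s t f }

/-- Unitary equivalence of unitary representations. -/
def UnitarilyEquivalent [NormedAddCommGroup X] [InnerProductSpace ℂ X]
    [NormedAddCommGroup Y] [InnerProductSpace ℂ Y]
    (π₁ : G →* (X ≃ₗᵢ[ℂ] X)) (π₂ : G →* (Y ≃ₗᵢ[ℂ] Y)) : Prop :=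
  ∃ T : X ≃ₗᵢ[ℂ] Y, ∀ s f, T (π₁ s f) = π₂ s (T f)

/-- Strong continuity of a unitary representation. -/
def StronglyContinuous [TopologicalSpace G] [NormedAddCommGroup X] [InnerProductSpace ℂ X]
    (π : G →* (X ≃ₗᵢ[ℂ] X)) : Prop :=
  ∀ f, Continuous fun s => π s f

end Generic

/-! ### Hermitian `G`-bundles with underlying vector bundle `M × V → M` -/

/-- A Hermitian `G`-bundle over the `G`-space `(M, l)` whose underlying vector bundle is the product
bundle `M × V → M`: a fibrewise Hermitian metric (conjugate-linear in the first variable) and an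
action of `G` on the total space covering `l` by isometric bundle isomorphisms. Smoothness is the
separate predicate `HermitianGBundle.IsSmooth`. -/
structure HermitianGBundle {G M : Type*} [Group G] [TopologicalSpace M] (l : G →* Equiv.Perm M)
    (V : Type*) [NormedAddCommGroup V] [InnerProductSpace ℂ V] where
  /-- the metric on the fibre `{x} × V` -/
  metric : M → V →ₗ⋆[ℂ] V →ₗ[ℂ] ℂ
  metric_symm : ∀ x v w, conj (metric x w v) = metric x v w
  metric_pos : ∀ x v, v ≠ 0 → 0 < (metric x v v).re
  continuous_metric : Continuous fun p : M × V × V => metric p.1 p.2.1 p.2.2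
  /-- the action on the total space -/
  act : G →* Equiv.Perm (M × V)
  act_fst : ∀ s p, (act s p).1 = l s p.1
  act_add : ∀ s x v w, (act s (x, v + w)).2 = (act s (x, v)).2 + (act s (x, w)).2
  act_smul : ∀ s x (c : ℂ) v, (act s (x, c • v)).2 = c • (act s (x, v)).2
  act_isometry : ∀ s x v w,
    metric (l s x) (act s (x, v)).2 (act s (x, w)).2 = metric x v w
  continuous_act : ∀ s, Continuous (act s)

namespace HermitianGBundle

variable {G M V : Type*} [Group G] [TopologicalSpace M]
  [NormedAddCommGroup V] [InnerProductSpace ℂ V] {l : G →* Equiv.Perm M}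

/-- The Hermitian `G`-bundle is smooth: the actions on the base and on the total space are smooth
actions of the Lie group `G`, and the metric is smooth. -/
structure IsSmooth (B : HermitianGBundle l V)
    {EG EM : Type*} [NormedAddCommGroup EG] [NormedSpace ℝ EG] [NormedAddCommGroup EM]
    [NormedSpace ℝ EM] [TopologicalSpace G] [ChartedSpace EG G] [ChartedSpace EM M] : Prop where
  base : ContMDiff (𝓘(ℝ, EG).prod 𝓘(ℝ, EM)) 𝓘(ℝ, EM) ∞ fun p : G × M => l p.1 p.2
  metric : ContMDiff (𝓘(ℝ, EM).prod (𝓘(ℝ, V).prod 𝓘(ℝ, V))) 𝓘(ℝ, ℂ) ∞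
    fun p : M × V × V => B.metric p.1 p.2.1 p.2.2
  act : ContMDiff (𝓘(ℝ, EG).prod (𝓘(ℝ, EM).prod 𝓘(ℝ, V))) (𝓘(ℝ, EM).prod 𝓘(ℝ, V)) ∞
    fun p : G × (M × V) => B.act p.1 p.2

/-- `α` is an isomorphism of Hermitian `G`-bundles over `M`: a diffeomorphism of the total spaces
over the identity of `M` that is fibrewise linear, isometric and `G`-equivariant. -/
structure IsIso (B B' : HermitianGBundle l V) (α : M × V → M × V)
    {EM : Type*} [NormedAddCommGroup EM] [NormedSpace ℝ EM] [ChartedSpace EM M] : Prop where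
  diffeo : ∃ e : Diffeomorph (𝓘(ℝ, EM).prod 𝓘(ℝ, V)) (𝓘(ℝ, EM).prod 𝓘(ℝ, V)) (M × V) (M × V) ∞,
    ⇑e = α
  fst : ∀ p, (α p).1 = p.1
  map_add : ∀ x v w, (α (x, v + w)).2 = (α (x, v)).2 + (α (x, w)).2
  map_smul : ∀ x (c : ℂ) v, (α (x, c • v)).2 = c • (α (x, v)).2
  isometry : ∀ x v w, B'.metric x (α (x, v)).2 (α (x, w)).2 = B.metric x v w
  equivariant : ∀ s p, α (B.act s p) = B'.act s (α p)

section L2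

theorem metric_nonneg (B : HermitianGBundle l V) (x : M) (v : V) : 0 ≤ (B.metric x v v).re := by
  by_cases hv : v = 0
  · simp [hv]
  · exact (B.metric_pos x v hv).le

theorem norm_metric_le (B : HermitianGBundle l V) (x : M) (v w : V) :
    ‖B.metric x v w‖ ≤ (B.metric x v v).re + (B.metric x w w).re := by
  let c : PreInnerProductSpace.Core ℂ V :=
    { inner := fun v w => B.metric x v w
      conj_inner_symm := fun v w => B.metric_symm x v w
      re_inner_nonneg := fun v => B.metric_nonneg x v
      add_left := fun u v w => by simp
      smul_left := fun u v r => by simp }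
  have h : ‖B.metric x v w‖ * ‖B.metric x w v‖ ≤ (B.metric x v v).re * (B.metric x w w).re :=
    InnerProductSpace.Core.inner_mul_inner_self_le (c := c) v w
  have h2 : ‖B.metric x w v‖ = ‖B.metric x v w‖ := by
    rw [← B.metric_symm x v w, RCLike.norm_conj]
  rw [h2] at h
  have h3 := B.metric_nonneg x v
  have h4 := B.metric_nonneg x w
  have h5 := norm_nonneg (B.metric x v w)
  nlinarith

theorem metric_add_self_le (B : HermitianGBundle l V) (x : M) (v w : V) :
    (B.metric x (v + w) (v + w)).re ≤ 2 * (B.metric x v v).re + 2 * (B.metric x w w).re := by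
  have h := B.metric_nonneg x (v - w)
  simp only [map_add, map_sub, LinearMap.add_apply, LinearMap.sub_apply, Complex.add_re,
    Complex.sub_re] at h ⊢
  linarith

variable [MeasurableSpace M] [OpensMeasurableSpace M] [FiniteDimensional ℂ V]
  [MeasurableSpace V] [BorelSpace V]

theorem measurable_metric (B : HermitianGBundle l V) {f g : M → V} (hf : Measurable f)
    (hg : Measurable g) : Measurable fun x => B.metric x (f x) (g x) := by
  have : ProperSpace V := FiniteDimensional.proper ℂ V
  have : SecondCountableTopology V := secondCountable_of_proper
  exact B.continuous_metric.measurable.comp (measurable_id.prodMk (hf.prodMk hg))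

/-- Borel sections `ψ(x) = (x, f x)` of `M × V` with `∫ h(ψ, ψ) dμ < ∞`. -/
def l2Submodule (B : HermitianGBundle l V) (μ : Measure M) : Submodule ℂ (M → V) where
  carrier := {f | Measurable f ∧ ∫⁻ x, ENNReal.ofReal (B.metric x (f x) (f x)).re ∂μ < ⊤}
  zero_mem' := ⟨measurable_const, by simp⟩
  add_mem' := by
    have : ProperSpace V := FiniteDimensional.proper ℂ V
    have : SecondCountableTopology V := secondCountable_of_proper
    rintro f g ⟨hf, hf'⟩ ⟨hg, hg'⟩
    refine ⟨hf.add hg, ?_⟩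
    have hm : Measurable fun x => ENNReal.ofReal (B.metric x (f x) (f x)).re :=
      (Complex.measurable_re.comp (B.measurable_metric hf hf)).ennreal_ofReal
    calc ∫⁻ x, ENNReal.ofReal (B.metric x ((f + g) x) ((f + g) x)).re ∂μ
        ≤ ∫⁻ x, (2 * ENNReal.ofReal (B.metric x (f x) (f x)).re
            + 2 * ENNReal.ofReal (B.metric x (g x) (g x)).re) ∂μ := by
          refine lintegral_mono fun x => ?_
          have h2 : (2 : ENNReal) = ENNReal.ofReal 2 := by simp
          rw [h2, ← ENNReal.ofReal_mul (by norm_num), ← ENNReal.ofReal_mul (by norm_num),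
            ← ENNReal.ofReal_add (by have := B.metric_nonneg x (f x); positivity)
              (by have := B.metric_nonneg x (g x); positivity)]
          exact ENNReal.ofReal_le_ofReal (B.metric_add_self_le x (f x) (g x))
      _ = 2 * ∫⁻ x, ENNReal.ofReal (B.metric x (f x) (f x)).re ∂μ
            + 2 * ∫⁻ x, ENNReal.ofReal (B.metric x (g x) (g x)).re ∂μ := by
          rw [lintegral_add_left (hm.const_mul 2), lintegral_const_mul' _ _ (by simp),
            lintegral_const_mul' _ _ (by simp)]
      _ < ⊤ := by
          refine ENNReal.add_lt_top.2 ⟨ENNReal.mul_lt_top (by simp) hf',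
            ENNReal.mul_lt_top (by simp) hg'⟩
  smul_mem' := by
    rintro c f ⟨hf, hf'⟩
    refine ⟨hf.const_smul c, ?_⟩
    have : ∀ x, ENNReal.ofReal (B.metric x ((c • f) x) ((c • f) x)).re
        = ENNReal.ofReal (‖c‖ ^ 2) * ENNReal.ofReal (B.metric x (f x) (f x)).re := by
      intro x
      rw [← ENNReal.ofReal_mul (by positivity)]
      congr 1
      have : B.metric x ((c • f) x) ((c • f) x) = ((‖c‖ ^ 2 : ℝ) : ℂ) * B.metric x (f x) (f x) := by
        simp only [Pi.smul_apply, map_smulₛₗ, LinearMap.smul_apply, smul_eq_mul, RingHom.id_apply]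
        rw [← mul_assoc, ← Complex.normSq_eq_norm_sq, ← Complex.mul_conj]
      rw [this, Complex.re_ofReal_mul]
    simp_rw [this]
    rw [lintegral_const_mul' _ _ (by simp)]
    exact ENNReal.mul_lt_top (by simp) hf'

/-- The space of square-integrable Borel sections, before identifying almost everywhere equal
sections; it is a pre-Hilbert space for `⟨ψ, φ⟩ = ∫ h(ψ, φ) dμ`. -/
def L2Pre (B : HermitianGBundle l V) (μ : Measure M) : Type _ := B.l2Submodule μ

variable (B : HermitianGBundle l V) (μ : Measure M)

instance : AddCommGroup (B.L2Pre μ) := inferInstanceAs (AddCommGroup (B.l2Submodule μ))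

instance : Module ℂ (B.L2Pre μ) := inferInstanceAs (Module ℂ (B.l2Submodule μ))

/-- The underlying function `f` of the section `x ↦ (x, f x)`. -/
def L2Pre.fn {B : HermitianGBundle l V} {μ : Measure M} (f : B.L2Pre μ) : M → V :=
  (B.l2Submodule μ).subtype f

instance : CoeFun (B.L2Pre μ) (fun _ => M → V) := ⟨L2Pre.fn⟩

/-- A square-integrable Borel section as an element of `L2Pre`. -/
def L2Pre.mk {B : HermitianGBundle l V} {μ : Measure M} (f : M → V) (hf : Measurable f)
    (hf' : ∫⁻ x, ENNReal.ofReal (B.metric x (f x) (f x)).re ∂μ < ⊤) : B.L2Pre μ :=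
  (⟨f, hf, hf'⟩ : B.l2Submodule μ)

variable {B μ} in
theorem L2Pre.ext {f g : B.L2Pre μ} (h : ∀ x, f x = g x) : f = g := Subtype.ext (funext h)

variable {B μ} in
theorem L2Pre.measurable (f : B.L2Pre μ) : Measurable f := Subtype.property f |>.1

variable {B μ} in
theorem L2Pre.lintegral_lt_top (f : B.L2Pre μ) :
    ∫⁻ x, ENNReal.ofReal (B.metric x (f x) (f x)).re ∂μ < ⊤ := Subtype.property f |>.2

theorem integrable_metric (f g : B.L2Pre μ) :
    Integrable (fun x => B.metric x (f x) (g x)) μ := by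
  have key : ∀ f : B.L2Pre μ, Integrable (fun x => (B.metric x (f x) (f x)).re) μ := fun f =>
    ⟨(Complex.measurable_re.comp (B.measurable_metric f.measurable f.measurable)).aestronglyMeasurable,
      (hasFiniteIntegral_iff_ofReal
        (Filter.Eventually.of_forall fun x => B.metric_nonneg x (f x))).2 f.lintegral_lt_top⟩
  exact ((key f).add (key g)).mono' (B.measurable_metric f.measurable g.measurable).aestronglyMeasurable
    (Filter.Eventually.of_forall fun x => B.norm_metric_le x (f x) (g x))

/-- The inner product `∫ h(ψ, φ) dμ`. -/
@[reducible]
def l2Core : PreInnerProductSpace.Core ℂ (B.L2Pre μ) :=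
  integralCore μ (fun f g x => B.metric x (f x) (g x)) (B.integrable_metric μ)
    (fun f g x => B.metric_symm x (f x) (g x)) (fun f x => B.metric_nonneg x (f x))
    (fun f g k x => by
      change B.metric x (f x + g x) (k x) = _
      simp)
    (fun c f g x => by
      change B.metric x (c • f x) (g x) = _
      simp)

instance : SeminormedAddCommGroup (B.L2Pre μ) :=
  @InnerProductSpace.Core.toSeminormedAddCommGroup ℂ _ _ _ _ (B.l2Core μ)

instance : InnerProductSpace ℂ (B.L2Pre μ) := InnerProductSpace.ofCore (B.l2Core μ)

/-- The `L²`-section space: square-integrable Borel sections modulo sections of norm zero, that is,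
modulo equality almost everywhere. -/
abbrev L2Section : Type _ := SeparationQuotient (B.L2Pre μ)

/-- The class of a square-integrable Borel section. -/
abbrev toL2 (f : B.L2Pre μ) : B.L2Section μ := SeparationQuotient.mk f

variable {μ}

/-- `f ↦ λ(s) ∘ f ∘ l_s⁻¹` on square-integrable Borel sections. -/
def preRepFun (hμ : ∀ s, MeasurePreserving (l s) μ μ) (s : G) (f : B.L2Pre μ) : B.L2Pre μ :=
  have hm : Measurable fun x => (B.act s ((l s)⁻¹ x, f ((l s)⁻¹ x))).2 := by
    have : ProperSpace V := FiniteDimensional.proper ℂ V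
    have : SecondCountableTopology V := secondCountable_of_proper
    have hl : Measurable ⇑(l s)⁻¹ := by
      have := (hμ s⁻¹).measurable
      rwa [map_inv] at this
    exact ((continuous_snd.comp (B.continuous_act s)).measurable).comp
      (hl.prodMk (f.measurable.comp hl))
  L2Pre.mk (fun x => (B.act s ((l s)⁻¹ x, f ((l s)⁻¹ x))).2) hm (by
    have h2 := f.lintegral_lt_top
    have h3 := (hμ s).lintegral_comp (f := fun x => ENNReal.ofReal
        (B.metric x (B.act s ((l s)⁻¹ x, f ((l s)⁻¹ x))).2
          (B.act s ((l s)⁻¹ x, f ((l s)⁻¹ x))).2).re)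
      (Complex.measurable_re.comp (B.measurable_metric hm hm)).ennreal_ofReal
    have h4 : ∀ x, (l s)⁻¹ (l s x) = x := (l s).symm_apply_apply
    simp only [B.act_isometry, h4] at h3
    rwa [← h3])

/-- The action `f ↦ λ(s) ∘ f ∘ l_s⁻¹` of `G` on square-integrable Borel sections. -/
def preRep (hμ : ∀ s, MeasurePreserving (l s) μ μ) : G →* Module.End ℂ (B.L2Pre μ) where
  toFun s :=
    { toFun := B.preRepFun hμ s
      map_add' := fun _ _ => L2Pre.ext fun _ => B.act_add s _ _ _
      map_smul' := fun c _ => L2Pre.ext fun _ => B.act_smul s _ c _ }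
  map_one' := LinearMap.ext fun f => L2Pre.ext fun x => by
    change (B.act 1 ((l 1)⁻¹ x, f ((l 1)⁻¹ x))).2 = f x
    simp
  map_mul' s t := LinearMap.ext fun f => L2Pre.ext fun x => by
    change (B.act (s * t) ((l (s * t))⁻¹ x, f ((l (s * t))⁻¹ x))).2
      = (B.act s ((l s)⁻¹ x, (B.act t ((l t)⁻¹ ((l s)⁻¹ x), f ((l t)⁻¹ ((l s)⁻¹ x)))).2)).2
    rw [map_mul, Equiv.Perm.mul_apply, map_mul, mul_inv_rev, Equiv.Perm.mul_apply]
    congr 2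
    refine Prod.ext ?_ rfl
    rw [B.act_fst]
    simp

theorem preRep_apply (hμ : ∀ s, MeasurePreserving (l s) μ μ) (s : G) (f : B.L2Pre μ) (x : M) :
    (x, B.preRep hμ s f x) = B.act s ((l s)⁻¹ x, f ((l s)⁻¹ x)) := by
  refine Prod.ext ?_ rfl
  rw [B.act_fst]
  simp

theorem norm_preRep (hμ : ∀ s, MeasurePreserving (l s) μ μ) (s : G) (f : B.L2Pre μ) :
    ‖B.preRep hμ s f‖ = ‖f‖ := by
  have hm := B.measurable_metric (B.preRep hμ s f).measurable (B.preRep hμ s f).measurable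
  change √(RCLike.re (∫ x, B.metric x (B.preRep hμ s f x) (B.preRep hμ s f x) ∂μ))
    = √(RCLike.re (∫ x, B.metric x (f x) (f x) ∂μ))
  congr 2
  have h : ∀ x, B.metric x (f x) (f x)
      = B.metric (l s x) (B.preRep hμ s f (l s x)) (B.preRep hμ s f (l s x)) := by
    intro x
    change _ = B.metric (l s x) (B.act s ((l s)⁻¹ (l s x), f ((l s)⁻¹ (l s x)))).2
      (B.act s ((l s)⁻¹ (l s x), f ((l s)⁻¹ (l s x)))).2
    rw [show (l s)⁻¹ (l s x) = x from (l s).symm_apply_apply x, B.act_isometry]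
  simp_rw [h]
  have h2 := integral_map (hμ s).measurable.aemeasurable (μ := μ)
    (f := fun x => B.metric x (B.preRep hμ s f x) (B.preRep hμ s f x))
    hm.aestronglyMeasurable
  rw [(hμ s).map_eq] at h2
  exact h2

/-- The induced representation `U(s) f = λ(s) ∘ f ∘ l_s⁻¹` on the `L²`-section space associated with
the Hermitian `G`-bundle `B` and the `G`-invariant measure `μ`. -/
def rep (hμ : ∀ s, MeasurePreserving (l s) μ μ) :
    G →* (B.L2Section μ ≃ₗᵢ[ℂ] B.L2Section μ) :=
  quotRep (B.preRep hμ) (B.norm_preRep hμ)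

end L2

end HermitianGBundle

/-! ### Induced representations

The coset space `G ⧸ K` carries the quotient σ-algebra (a set is measurable iff its preimage in `G`
is Borel); for a closed subgroup of a second countable Lie group this is the Borel σ-algebra of
`G ⧸ K`, see `CosetSpace.borelSpace`. -/

section Induced

instance quotientOpensMeasurableSpace {G : Type*} [Group G] [TopologicalSpace G]
    [MeasurableSpace G] [OpensMeasurableSpace G] (K : Subgroup G) :
    OpensMeasurableSpace (G ⧸ K) where
  borel_le := MeasurableSpace.generateFrom_le fun _ hs =>
    (hs.preimage QuotientGroup.continuous_mk).measurableSet

variable {G : Type*} [Group G] {K : Subgroup G}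
  {V : Type*} [NormedAddCommGroup V] [InnerProductSpace ℂ V] [CompleteSpace V]

/-- `f (g k) = σ(k)⁻¹ f(g)` for all `g ∈ G`, `k ∈ K`. -/
def IsCovariant (σ : K →* unitary (V →L[ℂ] V)) (f : G → V) : Prop :=
  ∀ (g : G) (k : K), f (g * k) = ((σ k)⁻¹ : unitary (V →L[ℂ] V)).1 (f g)

theorem unitary_inner (u : unitary (V →L[ℂ] V)) (v w : V) :
    inner ℂ (u.1 v) (u.1 w) = inner ℂ v w := by
  rw [← ContinuousLinearMap.adjoint_inner_right, ← ContinuousLinearMap.star_eq_adjoint,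
    ← mul_apply_eq_comp, Unitary.coe_star_mul_self, one_apply_eq_self]

/-- For covariant `f, f'` the function `g ↦ ⟨f g, f' g⟩` is constant on cosets, so that its value at
`gK` can be computed at the representative `(gK).out`. -/
theorem IsCovariant.inner_out {σ : K →* unitary (V →L[ℂ] V)} {f f' : G → V} (hf : IsCovariant σ f)
    (hf' : IsCovariant σ f') (g : G) :
    inner ℂ (f (g : G ⧸ K).out) (f' (g : G ⧸ K).out) = inner ℂ (f g) (f' g) := by
  obtain ⟨k, hk⟩ := QuotientGroup.mk_out_eq_mul K g
  rw [hk, hf, hf', unitary_inner]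

theorem IsCovariant.norm_out {σ : K →* unitary (V →L[ℂ] V)} {f : G → V} (hf : IsCovariant σ f)
    (g : G) : ‖f (g : G ⧸ K).out‖ = ‖f g‖ := by
  have := hf.inner_out hf g
  rw [inner_self_eq_norm_sq_to_K, inner_self_eq_norm_sq_to_K] at this
  have h2 : ‖f (g : G ⧸ K).out‖ ^ 2 = ‖f g‖ ^ 2 := by exact_mod_cast this
  exact (sq_eq_sq₀ (norm_nonneg _) (norm_nonneg _)).1 h2

variable [MeasurableSpace G] [MeasurableSpace V] [BorelSpace V]

theorem IsCovariant.measurable_enorm {σ : K →* unitary (V →L[ℂ] V)} {f : G → V}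
    (hf : IsCovariant σ f) (hm : Measurable f) : Measurable fun q : G ⧸ K => ‖f q.out‖ₑ := by
  refine QuotientGroup.measurable_from_quotient.2 ?_
  have : (fun q : G ⧸ K => ‖f q.out‖ₑ) ∘ ((↑) : G → G ⧸ K) = fun g => ‖f g‖ₑ := by
    funext g
    simp only [Function.comp, ← ofReal_norm, hf.norm_out g]
  rw [this]
  exact hm.enorm

variable [FiniteDimensional ℂ V]

theorem IsCovariant.measurable_inner {σ : K →* unitary (V →L[ℂ] V)} {f f' : G → V}
    (hf : IsCovariant σ f) (hf' : IsCovariant σ f') (hm : Measurable f) (hm' : Measurable f') :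
    Measurable fun q : G ⧸ K => inner ℂ (f q.out) (f' q.out) := by
  have : ProperSpace V := FiniteDimensional.proper ℂ V
  have : SecondCountableTopology V := secondCountable_of_proper
  refine QuotientGroup.measurable_from_quotient.2 ?_
  have : (fun q : G ⧸ K => inner ℂ (f q.out) (f' q.out)) ∘ ((↑) : G → G ⧸ K)
      = fun g => inner ℂ (f g) (f' g) := by
    funext g
    exact hf.inner_out hf' g
  rw [this]
  exact hm.inner hm'

/-- Borel functions `f : G → V` with `f (g k) = σ(k)⁻¹ f(g)` and
`∫_{G/K} ‖f(x)‖² dμ(xK) < ∞`. -/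
def indSubmodule (σ : K →* unitary (V →L[ℂ] V)) (μ : Measure (G ⧸ K)) :
    Submodule ℂ (G → V) where
  carrier := {f | Measurable f ∧ IsCovariant σ f ∧ ∫⁻ q : G ⧸ K, ‖f q.out‖ₑ ^ 2 ∂μ < ⊤}
  zero_mem' := ⟨measurable_const, fun g k => by simp, by simp⟩
  add_mem' := by
    have : ProperSpace V := FiniteDimensional.proper ℂ V
    have : SecondCountableTopology V := secondCountable_of_proper
    rintro f g ⟨hf, hf', hf''⟩ ⟨hg, hg', hg''⟩
    refine ⟨hf.add hg, fun x k => by simp [hf' x k, hg' x k], ?_⟩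
    calc ∫⁻ q : G ⧸ K, ‖(f + g) q.out‖ₑ ^ 2 ∂μ
        ≤ ∫⁻ q : G ⧸ K, (2 * ‖f q.out‖ₑ ^ 2 + 2 * ‖g q.out‖ₑ ^ 2) ∂μ := by
          refine lintegral_mono fun q => ?_
          have h2 : (2 : ENNReal) = ENNReal.ofReal 2 := by simp
          have e : ∀ v : V, ‖v‖ₑ ^ 2 = ENNReal.ofReal (‖v‖ ^ 2) := fun v => by
            rw [← ofReal_norm, ENNReal.ofReal_pow (norm_nonneg _)]
          rw [e, e, e, h2, ← ENNReal.ofReal_mul (by norm_num), ← ENNReal.ofReal_mul (by norm_num),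
            ← ENNReal.ofReal_add (by positivity) (by positivity)]
          refine ENNReal.ofReal_le_ofReal ?_
          have := norm_add_le (f q.out) (g q.out)
          have h0 := norm_nonneg (f q.out + g q.out)
          simp only [Pi.add_apply]
          nlinarith [sq_nonneg (‖f q.out‖ - ‖g q.out‖)]
      _ = 2 * ∫⁻ q : G ⧸ K, ‖f q.out‖ₑ ^ 2 ∂μ + 2 * ∫⁻ q : G ⧸ K, ‖g q.out‖ₑ ^ 2 ∂μ := by
          rw [lintegral_add_left (((hf'.measurable_enorm hf).pow_const 2).const_mul 2),
            lintegral_const_mul' _ _ (by simp), lintegral_const_mul' _ _ (by simp)]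
      _ < ⊤ := ENNReal.add_lt_top.2 ⟨ENNReal.mul_lt_top (by simp) hf'',
            ENNReal.mul_lt_top (by simp) hg''⟩
  smul_mem' := by
    rintro c f ⟨hf, hf', hf''⟩
    refine ⟨hf.const_smul c, fun x k => by simp [hf' x k], ?_⟩
    have : ∀ q : G ⧸ K, ‖(c • f) q.out‖ₑ ^ 2 = ‖c‖ₑ ^ 2 * ‖f q.out‖ₑ ^ 2 := fun q => by
      rw [Pi.smul_apply, enorm_smul, mul_pow]
    simp_rw [this]
    rw [lintegral_const_mul' _ _ (by simp)]
    exact ENNReal.mul_lt_top (by simp) hf''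

/-- The space `𝓕₀` of square-integrable covariant Borel functions, a pre-Hilbert space for
`⟨f, f'⟩ = ∫_{G/K} ⟨f(x), f'(x)⟩ dμ(xK)`. -/
def IndPre (σ : K →* unitary (V →L[ℂ] V)) (μ : Measure (G ⧸ K)) : Type _ := indSubmodule σ μ

variable (σ : K →* unitary (V →L[ℂ] V)) (μ : Measure (G ⧸ K))

instance : AddCommGroup (IndPre σ μ) := inferInstanceAs (AddCommGroup (indSubmodule σ μ))

instance : Module ℂ (IndPre σ μ) := inferInstanceAs (Module ℂ (indSubmodule σ μ))

/-- The underlying function on `G`. -/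
def IndPre.fn {σ : K →* unitary (V →L[ℂ] V)} {μ : Measure (G ⧸ K)} (f : IndPre σ μ) : G → V :=
  (indSubmodule σ μ).subtype f

instance : CoeFun (IndPre σ μ) (fun _ => G → V) := ⟨IndPre.fn⟩

/-- A square-integrable covariant Borel function as an element of `IndPre`. -/
def IndPre.mk {σ : K →* unitary (V →L[ℂ] V)} {μ : Measure (G ⧸ K)} (f : G → V)
    (hf : Measurable f) (hc : IsCovariant σ f)
    (hf' : ∫⁻ q : G ⧸ K, ‖f q.out‖ₑ ^ 2 ∂μ < ⊤) : IndPre σ μ :=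
  (⟨f, hf, hc, hf'⟩ : indSubmodule σ μ)

variable {σ μ} in
theorem IndPre.ext {f g : IndPre σ μ} (h : ∀ x, f x = g x) : f = g := Subtype.ext (funext h)

variable {σ μ} in
theorem IndPre.measurable (f : IndPre σ μ) : Measurable f := Subtype.property f |>.1

variable {σ μ} in
theorem IndPre.covariant (f : IndPre σ μ) : IsCovariant σ f := Subtype.property f |>.2.1

variable {σ μ} in
theorem IndPre.lintegral_lt_top (f : IndPre σ μ) :
    ∫⁻ q : G ⧸ K, ‖f q.out‖ₑ ^ 2 ∂μ < ⊤ := Subtype.property f |>.2.2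

theorem integrable_ind (f f' : IndPre σ μ) :
    Integrable (fun q : G ⧸ K => inner ℂ (f q.out) (f' q.out)) μ := by
  have key : ∀ f : IndPre σ μ, Integrable (fun q : G ⧸ K => ‖f q.out‖ ^ 2) μ := fun f => by
    have hm : Measurable fun q : G ⧸ K => ‖f q.out‖ ^ 2 := by
      have := ((f.covariant.measurable_enorm f.measurable).ennreal_toReal).pow_const 2
      simpa using this
    refine ⟨hm.aestronglyMeasurable, (hasFiniteIntegral_iff_ofReal
        (Filter.Eventually.of_forall fun x => by positivity)).2 ?_⟩
    have e : ∀ v : V, ENNReal.ofReal (‖v‖ ^ 2) = ‖v‖ₑ ^ 2 := fun v => by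
      rw [← ofReal_norm, ENNReal.ofReal_pow (norm_nonneg _)]
    simp_rw [e]
    exact f.lintegral_lt_top
  refine ((key f).add (key f')).mono'
    (f.covariant.measurable_inner f'.covariant f.measurable f'.measurable).aestronglyMeasurable
    (Filter.Eventually.of_forall fun q => ?_)
  have := norm_inner_le_norm (𝕜 := ℂ) (f q.out) (f' q.out)
  simp only [Pi.add_apply]
  nlinarith [sq_nonneg (‖f q.out‖ - ‖f' q.out‖), sq_nonneg (‖f q.out‖), sq_nonneg (‖f' q.out‖)]

/-- The inner product `∫_{G/K} ⟨f(x), f'(x)⟩ dμ(xK)`. -/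
@[reducible]
def indCore : PreInnerProductSpace.Core ℂ (IndPre σ μ) :=
  integralCore μ (fun f f' (q : G ⧸ K) => inner ℂ (f q.out) (f' q.out)) (integrable_ind σ μ)
    (fun _ _ _ => inner_conj_symm _ _) (fun _ _ => inner_self_nonneg (𝕜 := ℂ))
    (fun f g k q => inner_add_left (𝕜 := ℂ) (f q.out) (g q.out) (k q.out))
    (fun c f g q => inner_smul_left (𝕜 := ℂ) (f q.out) (g q.out) c)

instance : SeminormedAddCommGroup (IndPre σ μ) :=
  @InnerProductSpace.Core.toSeminormedAddCommGroup ℂ _ _ _ _ (indCore σ μ)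

instance : InnerProductSpace ℂ (IndPre σ μ) := InnerProductSpace.ofCore (indCore σ μ)

/-- The space `𝓕` of the induced representation: `𝓕₀` modulo functions of norm zero. -/
abbrev IndSpace : Type _ := SeparationQuotient (IndPre σ μ)

variable {μ} [MeasurableMul G]

/-- `[x f](y) = f (x⁻¹ y)` on `𝓕₀`. -/
def indPreRepFun (hμ : ∀ x : G, MeasurePreserving (fun q : G ⧸ K => x • q) μ μ) (x : G)
    (f : IndPre σ μ) : IndPre σ μ :=
  have hm : Measurable fun y => f (x⁻¹ * y) := f.measurable.comp (measurable_const_mul x⁻¹)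
  have hc : IsCovariant σ fun y => f (x⁻¹ * y) := fun y k => by
    have := f.covariant (x⁻¹ * y) k
    rwa [mul_assoc] at this
  IndPre.mk (fun y => f (x⁻¹ * y)) hm hc (by
    have h2 := f.lintegral_lt_top
    rw [← (hμ x).lintegral_comp ((hc.measurable_enorm hm).pow_const 2)]
    convert h2 using 2
    funext q
    obtain ⟨y, rfl⟩ := QuotientGroup.mk_surjective q
    congr 1
    rw [← ofReal_norm, ← ofReal_norm, f.covariant.norm_out y]
    have := hc.norm_out (x * y)
    rw [inv_mul_cancel_left] at this
    rw [← this]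
    rfl)

/-- The action `[x f](y) = f (x⁻¹ y)` of `G` on `𝓕₀`. -/
def indPreRep (hμ : ∀ x : G, MeasurePreserving (fun q : G ⧸ K => x • q) μ μ) :
    G →* Module.End ℂ (IndPre σ μ) where
  toFun x :=
    { toFun := indPreRepFun σ hμ x
      map_add' := fun _ _ => IndPre.ext fun _ => rfl
      map_smul' := fun _ _ => IndPre.ext fun _ => rfl }
  map_one' := LinearMap.ext fun f => IndPre.ext fun y => by
    change f (1⁻¹ * y) = f y
    simp
  map_mul' x z := LinearMap.ext fun f => IndPre.ext fun y => by
    change f ((x * z)⁻¹ * y) = f (z⁻¹ * (x⁻¹ * y))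
    rw [mul_inv_rev, mul_assoc]

theorem norm_indPreRep (hμ : ∀ x : G, MeasurePreserving (fun q : G ⧸ K => x • q) μ μ) (x : G)
    (f : IndPre σ μ) : ‖indPreRep σ hμ x f‖ = ‖f‖ := by
  set F := indPreRep σ hμ x f with hF
  have hm := F.covariant.measurable_inner F.covariant F.measurable F.measurable
  change √(RCLike.re (∫ q : G ⧸ K, inner ℂ (F q.out) (F q.out) ∂μ))
    = √(RCLike.re (∫ q : G ⧸ K, inner ℂ (f q.out) (f q.out) ∂μ))
  congr 2
  have h : ∀ q : G ⧸ K, inner ℂ (f q.out) (f q.out)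
      = inner ℂ (F (x • q).out) (F (x • q).out) := by
    intro q
    obtain ⟨y, rfl⟩ := QuotientGroup.mk_surjective q
    rw [f.covariant.inner_out f.covariant y]
    have h1 := F.covariant.inner_out F.covariant (x * y)
    have h2 : F (x * y) = f y := by
      change f (x⁻¹ * (x * y)) = f y
      rw [inv_mul_cancel_left]
    rw [h2] at h1
    exact h1.symm
  simp_rw [h]
  have h2 := integral_map (hμ x).measurable.aemeasurable (μ := μ)
    (f := fun q : G ⧸ K => inner ℂ (F q.out) (F q.out)) hm.aestronglyMeasurable
  rw [(hμ x).map_eq] at h2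
  exact h2

/-- The induced representation `Ind_K^G σ`, realised with the `G`-invariant measure `μ` on `G/K`. -/
def indRep (hμ : ∀ x : G, MeasurePreserving (fun q : G ⧸ K => x • q) μ μ) :
    G →* (IndSpace σ μ ≃ₗᵢ[ℂ] IndSpace σ μ) :=
  quotRep (indPreRep σ hμ) (norm_indPreRep σ hμ)

end Induced

/-! ### Semidirect products, little groups and the two bundles -/

section Semidirect

variable {G : Type*} [Group G]

/-- The multiplication map `N × H → G`, `(n, h) ↦ n h`. -/
def mulMap (N H : Subgroup G) : N × H → G := fun p => p.1 * p.2

/-- The Lie group `G` is the semidirect product `N ⋉ H` of its closed subgroups `N` (abelian; that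
`N` is normal is a separate hypothesis) and `H`: the map `(n, h) ↦ n h` is a diffeomorphism of
`N × H` onto `G`. -/
structure IsLieSemidirect {EG EN EH : Type*} [NormedAddCommGroup EG] [NormedSpace ℝ EG]
    [NormedAddCommGroup EN] [NormedSpace ℝ EN] [NormedAddCommGroup EH] [NormedSpace ℝ EH]
    [TopologicalSpace G] [ChartedSpace EG G] (N H : Subgroup G)
    [ChartedSpace EN N] [ChartedSpace EH H] : Prop where
  isClosed_N : IsClosed (N : Set G)
  isClosed_H : IsClosed (H : Set G)
  comm : ∀ a b : N, a * b = b * a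
  diffeo : ∃ e : Diffeomorph (𝓘(ℝ, EN).prod 𝓘(ℝ, EH)) 𝓘(ℝ, EG) (N × H) G ∞, ⇑e = mulMap N H

theorem IsLieSemidirect.bijective {EG EN EH : Type*} [NormedAddCommGroup EG] [NormedSpace ℝ EG]
    [NormedAddCommGroup EN] [NormedSpace ℝ EN] [NormedAddCommGroup EH] [NormedSpace ℝ EH]
    [TopologicalSpace G] [ChartedSpace EG G] {N H : Subgroup G}
    [ChartedSpace EN N] [ChartedSpace EH H] (h : IsLieSemidirect (EG := EG) (EN := EN) (EH := EH) N H) :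
    Function.Bijective (mulMap N H) := by
  obtain ⟨e, he⟩ := h.diffeo
  rw [← he]
  exact e.bijective

variable {N H : Subgroup G}

/-- The component `n` of `g = n h`. -/
def nPart (hNH : Function.Bijective (mulMap N H)) (g : G) : N :=
  ((Equiv.ofBijective _ hNH).symm g).1

/-- The component `h` of `g = n h`. -/
def hPart (hNH : Function.Bijective (mulMap N H)) (g : G) : H :=
  ((Equiv.ofBijective _ hNH).symm g).2

theorem nPart_mul_hPart (hNH : Function.Bijective (mulMap N H)) (g : G) :
    (nPart hNH g : G) * hPart hNH g = g :=
  (Equiv.ofBijective _ hNH).apply_symm_apply g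

theorem parts_eq (hNH : Function.Bijective (mulMap N H)) {g : G} {n : N} {h : H}
    (hg : (n : G) * h = g) : nPart hNH g = n ∧ hPart hNH g = h := by
  have : (Equiv.ofBijective _ hNH).symm g = (n, h) := by
    rw [Equiv.symm_apply_eq]
    exact hg.symm
  simp [nPart, hPart, this]

theorem parts_one (hNH : Function.Bijective (mulMap N H)) :
    nPart hNH 1 = 1 ∧ hPart hNH 1 = 1 := parts_eq hNH (by simp)

variable [N.Normal]

theorem parts_mul (hNH : Function.Bijective (mulMap N H)) (s t : G) :
    nPart hNH (s * t) = nPart hNH s * MulAut.conjNormal (hPart hNH s : G) (nPart hNH t) ∧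
      hPart hNH (s * t) = hPart hNH s * hPart hNH t := by
  refine parts_eq hNH ?_
  simp only [Subgroup.coe_mul, MulAut.conjNormal_apply]
  conv_rhs => rw [← nPart_mul_hPart hNH s, ← nPart_mul_hPart hNH t]
  group

/-- The projection `n h ↦ h` as a group homomorphism. -/
def hPartHom (hNH : Function.Bijective (mulMap N H)) : G →* H where
  toFun := hPart hNH
  map_one' := (parts_one hNH).2
  map_mul' s t := (parts_mul hNH s t).2

/-- The isotropy group `G_ν = {x | x · ν = ν}` of a character `ν` of `N`, where
`(x · ν)(n) = ν (x⁻¹ n x)`. -/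
def isotropy (ν : N →* Circle) : Subgroup G where
  carrier := {x | ∀ n : N, ν (MulAut.conjNormal x⁻¹ n) = ν n}
  one_mem' n := by simp
  mul_mem' := by
    intro a b ha hb n
    rw [mul_inv_rev, map_mul, MulAut.mul_apply, hb, ha]
  inv_mem' := by
    intro a ha n
    have := ha (MulAut.conjNormal a n)
    rw [← MulAut.mul_apply, ← map_mul, inv_mul_cancel, map_one, MulAut.one_apply] at this
    rw [inv_inv, this]

variable (H) in
/-- The little group `H_ν = H ∩ G_ν`, as a subgroup of `H`. -/
def littleGroup (ν : N →* Circle) : Subgroup H := (isotropy ν).subgroupOf H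

theorem coe_mem_isotropy (ν : N →* Circle) (n : N) : (n : G) ∈ isotropy ν := by
  intro m
  have : (MulAut.conjNormal (n : G)⁻¹ m : N) = n⁻¹ * m * n := by
    ext
    simp
  rw [this, map_mul, map_mul, map_inv, mul_right_comm, inv_mul_cancel, one_mul]

theorem hPart_mem_littleGroup (hNH : Function.Bijective (mulMap N H)) {ν : N →* Circle} {g : G}
    (hg : g ∈ isotropy ν) : hPart hNH g ∈ littleGroup H ν := by
  change (hPart hNH g : G) ∈ isotropy ν
  have : (hPart hNH g : G) = (nPart hNH g : G)⁻¹ * g := by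
    rw [eq_inv_mul_iff_mul_eq, nPart_mul_hPart]
  rw [this]
  exact mul_mem (inv_mem (coe_mem_isotropy ν _)) hg

/-- The action of `G = N ⋉ H` on `H / H_ν`, through `H`: `l_{nh}(y H_ν) = h y H_ν`. -/
def baseAction (hNH : Function.Bijective (mulMap N H)) (ν : N →* Circle) :
    G →* Equiv.Perm (H ⧸ littleGroup H ν) :=
  (MulAction.toPermHom H (H ⧸ littleGroup H ν)).comp (hPartHom hNH)

/-- The bijection `H / H_ν → G / G_ν`, `h H_ν ↦ h G_ν`. -/
def cosetMap (H : Subgroup G) (ν : N →* Circle) : H ⧸ littleGroup H ν → G ⧸ isotropy ν :=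
  Quotient.map' (fun h : H => (h : G)) fun a b hab => by
    rw [QuotientGroup.leftRel_apply] at hab ⊢
    exact hab

/-- The function `y H_ν ↦ ν (y⁻¹ n y)` on `H / H_ν`. -/
def charTwist (ν : N →* Circle) (n : N) : H ⧸ littleGroup H ν → Circle :=
  Quotient.lift (fun y : H => ν (MulAut.conjNormal (y : G)⁻¹ n)) fun a b hab => by
    have hab' : a⁻¹ * b ∈ littleGroup H ν := QuotientGroup.leftRel_apply.1 hab
    have h : ((a⁻¹ * b : H) : G) ∈ isotropy ν := hab'
    have h2 := h (MulAut.conjNormal (a : G)⁻¹ n)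
    rw [← MulAut.mul_apply, ← map_mul] at h2
    rw [← h2]
    congr 3
    simp

theorem charTwist_mk (ν : N →* Circle) (n : N) (y : H) :
    charTwist ν n (y : H ⧸ littleGroup H ν) = ν (MulAut.conjNormal (y : G)⁻¹ n) := rfl

theorem charTwist_one (ν : N →* Circle) (q : H ⧸ littleGroup H ν) : charTwist ν 1 q = 1 := by
  obtain ⟨y, rfl⟩ := QuotientGroup.mk_surjective q
  simp [charTwist_mk]

theorem charTwist_mul (ν : N →* Circle) (n m : N) (q : H ⧸ littleGroup H ν) :
    charTwist ν (n * m) q = charTwist ν n q * charTwist ν m q := by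
  obtain ⟨y, rfl⟩ := QuotientGroup.mk_surjective q
  simp [charTwist_mk]

theorem charTwist_conj (ν : N →* Circle) (h : H) (n : N) (q : H ⧸ littleGroup H ν) :
    charTwist ν (MulAut.conjNormal (h : G) n) (h • q) = charTwist ν n q := by
  obtain ⟨y, rfl⟩ := QuotientGroup.mk_surjective q
  rw [MulAction.Quotient.smul_coe, charTwist_mk, charTwist_mk, ← MulAut.mul_apply, ← map_mul]
  congr 3
  simp

variable {V : Type*} [NormedAddCommGroup V] [InnerProductSpace ℂ V] [CompleteSpace V]

/-- A complex number of modulus one as a unitary operator. -/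
def circleUnitary (V : Type*) [NormedAddCommGroup V] [InnerProductSpace ℂ V] [CompleteSpace V] :
    Circle →* unitary (V →L[ℂ] V) where
  toFun z := ⟨(z : ℂ) • 1, by
    have h : conj (z : ℂ) * z = 1 := by
      rw [← Complex.normSq_eq_conj_mul_self]; simp
    have h' : (z : ℂ) * conj (z : ℂ) = 1 := by rw [mul_comm, h]
    constructor
    · simp [star_smul, smul_smul, h']
    · simp [star_smul, smul_smul, h]⟩
  map_one' := by ext; simp
  map_mul' a b := by
    ext v
    simp [smul_smul, mul_comm]

theorem circleUnitary_apply (z : Circle) (v : V) : (circleUnitary V z).1 v = (z : ℂ) • v := rfl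

/-- The representation `ν σ : G_ν → U(V)`, `(ν σ)(n h) = ν(n) σ(h)` for `n ∈ N`, `h ∈ H_ν`. -/
def nuSigma (hNH : Function.Bijective (mulMap N H)) (ν : N →* Circle)
    (σ : littleGroup H ν →* unitary (V →L[ℂ] V)) : isotropy ν →* unitary (V →L[ℂ] V) where
  toFun g := circleUnitary V (ν (nPart hNH g)) * σ ⟨hPart hNH g, hPart_mem_littleGroup hNH g.2⟩
  map_one' := by
    have h1 : nPart hNH ((1 : isotropy ν) : G) = 1 := (parts_one hNH).1
    have h2 : (⟨hPart hNH ((1 : isotropy ν) : G), hPart_mem_littleGroup hNH (one_mem _)⟩ :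
      littleGroup H ν) = 1 := Subtype.ext (parts_one hNH).2
    rw [h1, h2]
    simp
  map_mul' s t := by
    have h1 : ν (nPart hNH ((s * t : isotropy ν) : G)) = ν (nPart hNH s) * ν (nPart hNH t) := by
      have := inv_mem (hPart_mem_littleGroup hNH s.2) (nPart hNH (t : G))
      rw [Subgroup.coe_mul, (parts_mul hNH s t).1, map_mul]
      simpa using this
    have h2 : (⟨hPart hNH ((s * t : isotropy ν) : G), hPart_mem_littleGroup hNH (s * t).2⟩ :
        littleGroup H ν) = ⟨hPart hNH s, hPart_mem_littleGroup hNH s.2⟩ *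
          ⟨hPart hNH t, hPart_mem_littleGroup hNH t.2⟩ := Subtype.ext (parts_mul hNH s t).2
    rw [h1, h2, map_mul, map_mul]
    have hc : ∀ (z : Circle) (u : unitary (V →L[ℂ] V)),
        u * circleUnitary V z = circleUnitary V z * u := by
      intro z u
      ext v
      simp [circleUnitary]
    simp only [mul_assoc]
    rw [← mul_assoc (σ _) (circleUnitary V _), hc, mul_assoc]

/-- The sesquilinear form `(v, w) ↦ ⟨v, A w⟩`. -/
def formOf (A : V →L[ℂ] V) : V →ₗ⋆[ℂ] V →ₗ[ℂ] ℂ :=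
  LinearMap.mk₂'ₛₗ (starRingEnd ℂ) (RingHom.id ℂ) (fun v w => inner ℂ v (A w))
    (fun _ _ _ => inner_add_left _ _ _) (fun _ _ _ => inner_smul_left _ _ _)
    (fun _ _ _ => by rw [map_add, inner_add_right])
    (fun _ _ _ => by rw [map_smul, inner_smul_right]; rfl)

theorem formOf_apply (A : V →L[ℂ] V) (v w : V) : formOf A v w = inner ℂ v (A w) := rfl

section Perception

variable {ν : N →* Circle} {σ : littleGroup H ν →* unitary (V →L[ℂ] V)}
  {Φ : H →* (V →L[ℂ] V)ˣ}

/-- The operator `Φ(x)^{†-1} Φ(x)^{-1}`, a function of the coset `x H_ν` because the restriction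
`σ` of `Φ` to `H_ν` is unitary. -/
def perceptionOp (hΦσ : ∀ k : littleGroup H ν, (Φ k : V →L[ℂ] V) = σ k) :
    H ⧸ littleGroup H ν → V →L[ℂ] V :=
  Quotient.lift (fun x : H => (((star (Φ x))⁻¹ * (Φ x)⁻¹ : (V →L[ℂ] V)ˣ) : V →L[ℂ] V))
    fun a b hab => by
      have hab' : a⁻¹ * b ∈ littleGroup H ν := QuotientGroup.leftRel_apply.1 hab
      obtain ⟨k, hk⟩ : ∃ k : littleGroup H ν, b = a * k := ⟨⟨_, hab'⟩, by simp⟩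
      have h1 : Φ k * star (Φ k) = 1 := by
        ext1
        simp [hΦσ]
      congr 1
      rw [hk, map_mul, ← mul_inv_rev, ← mul_inv_rev, star_mul, mul_assoc,
        ← mul_assoc (Φ (k : H)), h1, one_mul]

theorem formOf_perceptionOp_mk (hΦσ : ∀ k : littleGroup H ν, (Φ k : V →L[ℂ] V) = σ k) (x : H)
    (v w : V) : formOf (perceptionOp hΦσ x) v w
      = inner ℂ ((Φ x⁻¹ : V →L[ℂ] V) v) ((Φ x⁻¹ : V →L[ℂ] V) w) := by
  change inner ℂ v ((((star (Φ x))⁻¹ * (Φ x)⁻¹ : (V →L[ℂ] V)ˣ) : V →L[ℂ] V) w) = _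
  rw [← star_inv, ← map_inv, Units.val_mul, mul_apply_eq_comp, Units.coe_star,
    ContinuousLinearMap.star_eq_adjoint, ContinuousLinearMap.adjoint_inner_right]

variable [TopologicalSpace G] [IsTopologicalGroup G]

theorem continuous_charTwist (hν : Continuous ν) (n : N) :
    Continuous (charTwist (H := H) ν n) := by
  refine QuotientGroup.isOpenQuotientMap_mk.isQuotientMap.continuous_iff.2 ?_
  change Continuous fun y : H => ν (MulAut.conjNormal (y : G)⁻¹ n)
  have h : Continuous fun y : H => (y : G)⁻¹ * n * y := by fun_prop
  refine hν.comp (continuous_induced_rng.2 ?_)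
  refine h.congr fun y => ?_
  simp

/-- The perception bundle `E_σ`: the product bundle `H/H_ν × V` with the metric
`h((xH_ν, v), (xH_ν, w)) = ⟨v, Φ(x)^{†-1} Φ(x)^{-1} w⟩` and the action
`λ(n h)(yH_ν, v) = (h y H_ν, ν((h y)⁻¹ n h y) Φ(h) v)`. -/
def perceptionBundle (hNH : Function.Bijective (mulMap N H)) (hν : Continuous ν)
    (hΦ : Continuous fun x => (Φ x : V →L[ℂ] V))
    (hΦσ : ∀ k : littleGroup H ν, (Φ k : V →L[ℂ] V) = σ k) :
    HermitianGBundle (baseAction hNH ν) V where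
  metric x := formOf (perceptionOp hΦσ x)
  metric_symm q v w := by
    obtain ⟨x, rfl⟩ := QuotientGroup.mk_surjective q
    rw [formOf_perceptionOp_mk, formOf_perceptionOp_mk, inner_conj_symm]
  metric_pos q v hv := by
    obtain ⟨x, rfl⟩ := QuotientGroup.mk_surjective q
    rw [formOf_perceptionOp_mk]
    have h : (Φ x⁻¹ : V →L[ℂ] V) v ≠ 0 := by
      intro h0
      apply hv
      have : (Φ x : V →L[ℂ] V) ((Φ x⁻¹ : V →L[ℂ] V) v) = v := by
        rw [← mul_apply_eq_comp, ← Units.val_mul, ← map_mul]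
        simp
      rw [← this, h0, map_zero]
    exact (re_inner_self_pos (𝕜 := ℂ)).2 h
  continuous_metric := by
    have hq := ((QuotientGroup.isOpenQuotientMap_mk (N := littleGroup H ν)).prodMap
      (IsOpenQuotientMap.id (X := V × V))).isQuotientMap
    refine hq.continuous_iff.2 ?_
    have : ((fun p : (H ⧸ littleGroup H ν) × V × V => formOf (perceptionOp hΦσ p.1) p.2.1 p.2.2) ∘
        Prod.map (QuotientGroup.mk : H → H ⧸ littleGroup H ν) id)
        = fun p : H × V × V =>
          inner ℂ ((Φ p.1⁻¹ : V →L[ℂ] V) p.2.1) ((Φ p.1⁻¹ : V →L[ℂ] V) p.2.2) := by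
      funext p
      exact formOf_perceptionOp_mk hΦσ p.1 p.2.1 p.2.2
    rw [this]
    have h2 : Continuous fun p : H × V × V => (Φ p.1⁻¹ : V →L[ℂ] V) :=
      hΦ.comp continuous_fst.inv
    exact (h2.clm_apply (by fun_prop)).inner (h2.clm_apply (by fun_prop))
  act := MonoidHom.toHomPerm
    { toFun := fun s p => (hPart hNH s • p.1,
        (charTwist ν (nPart hNH s) (hPart hNH s • p.1) : ℂ) • (Φ (hPart hNH s) : V →L[ℂ] V) p.2)
      map_one' := by
        funext p
        rw [(parts_one hNH).1, (parts_one hNH).2]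
        refine Prod.ext (one_smul _ _) ?_
        change _ = p.2
        simp [charTwist_one]
      map_mul' := fun s t => by
        funext p
        rw [(parts_mul hNH s t).1, (parts_mul hNH s t).2]
        refine Prod.ext (mul_smul _ _ _) ?_
        change _ = (charTwist ν (nPart hNH s) (hPart hNH s • hPart hNH t • p.1) : ℂ) •
          (Φ (hPart hNH s) : V →L[ℂ] V) ((charTwist ν (nPart hNH t) (hPart hNH t • p.1) : ℂ) •
            (Φ (hPart hNH t) : V →L[ℂ] V) p.2)
        rw [charTwist_mul, mul_smul (hPart hNH s) (hPart hNH t) p.1, charTwist_conj, map_smul,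
          map_mul, Units.val_mul, mul_apply_eq_comp, Circle.coe_mul, mul_smul] }
  act_fst _ _ := rfl
  act_add s x v w := by
    change _ • _ = _ • _ + _ • _
    rw [map_add, smul_add]
  act_smul s x c v := by
    change _ • _ = c • _ • _
    rw [map_smul, smul_comm]
  act_isometry s q v w := by
    obtain ⟨x, rfl⟩ := QuotientGroup.mk_surjective q
    change formOf (perceptionOp hΦσ ((hPart hNH s * x : H) : H ⧸ littleGroup H ν))
      ((_ : ℂ) • _) ((_ : ℂ) • _) = _
    rw [formOf_perceptionOp_mk, formOf_perceptionOp_mk]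
    have h : ∀ v, (Φ (hPart hNH s * x)⁻¹ : V →L[ℂ] V) ((Φ (hPart hNH s) : V →L[ℂ] V) v)
        = (Φ x⁻¹ : V →L[ℂ] V) v := fun v => by
      rw [← mul_apply_eq_comp, ← Units.val_mul, ← map_mul]
      simp
    rw [map_smul, map_smul, ← circleUnitary_apply, ← circleUnitary_apply, unitary_inner, h, h]
  continuous_act s := by
    have h1 : Continuous fun p : (H ⧸ littleGroup H ν) × V => hPart hNH s • p.1 :=
      (continuous_const_smul _).comp continuous_fst
    have h2 : Continuous fun p : (H ⧸ littleGroup H ν) × V =>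
        (charTwist ν (nPart hNH s) (hPart hNH s • p.1) : ℂ) :=
      continuous_subtype_val.comp ((continuous_charTwist hν _).comp h1)
    exact h1.prodMk (h2.smul ((Φ (hPart hNH s) : V →L[ℂ] V).continuous.comp continuous_snd))

theorem perceptionBundle_act (hNH : Function.Bijective (mulMap N H)) (hν : Continuous ν)
    (hΦ : Continuous fun x => (Φ x : V →L[ℂ] V))
    (hΦσ : ∀ k : littleGroup H ν, (Φ k : V →L[ℂ] V) = σ k) (n : N) (h y : H) (v : V) :
    (perceptionBundle hNH hν hΦ hΦσ).act (n * h) ((y : H ⧸ littleGroup H ν), v)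
      = (((h * y : H) : H ⧸ littleGroup H ν),
          (ν (MulAut.conjNormal ((h * y : H) : G)⁻¹ n) : ℂ) • (Φ h : V →L[ℂ] V) v) := by
  obtain ⟨h1, h2⟩ := parts_eq hNH (g := n * h) rfl
  change (hPart hNH (n * h) • (y : H ⧸ littleGroup H ν),
    (charTwist ν (nPart hNH (n * h)) (hPart hNH (n * h) • (y : H ⧸ littleGroup H ν)) : ℂ) •
      (Φ (hPart hNH (n * h)) : V →L[ℂ] V) v) = _
  rw [h1, h2]
  rfl

end Perception

section Boosting

variable {ν : N →* Circle}

/-- The Wigner transformation `W_L(x, yH_ν) = L(x y H_ν)⁻¹ x L(y H_ν)`, an element of `H_ν`. -/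
def wigner {L : H ⧸ littleGroup H ν → H} (hL : ∀ q, (L q : H ⧸ littleGroup H ν) = q)
    (x : H) (q : H ⧸ littleGroup H ν) : littleGroup H ν :=
  ⟨(L (x • q))⁻¹ * x * L q, by
    rw [mul_assoc, ← QuotientGroup.eq, hL, ← smul_eq_mul, ← MulAction.Quotient.smul_coe, hL]⟩

theorem wigner_one {L : H ⧸ littleGroup H ν → H} (hL : ∀ q, (L q : H ⧸ littleGroup H ν) = q)
    (q : H ⧸ littleGroup H ν) : wigner hL 1 q = 1 := by
  ext
  simp [wigner]

theorem wigner_mul {L : H ⧸ littleGroup H ν → H} (hL : ∀ q, (L q : H ⧸ littleGroup H ν) = q)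
    (x y : H) (q : H ⧸ littleGroup H ν) :
    wigner hL (x * y) q = wigner hL x (y • q) * wigner hL y q := by
  refine Subtype.ext ?_
  simp only [wigner, mul_smul, Subgroup.coe_mul]
  group

variable [TopologicalSpace G] [IsTopologicalGroup G]

/-- The boosting bundle `E_{L,σ}`: the product bundle `H/H_ν × V` with the metric
`h_L((xH_ν, v), (xH_ν, w)) = ⟨v, w⟩` and the action
`λ_L(n h)(yH_ν, v) = (h y H_ν, ν((h y)⁻¹ n h y) σ(W_L(h, yH_ν)) v)`. -/
def boostingBundle (hNH : Function.Bijective (mulMap N H)) (hν : Continuous ν)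
    {σ : littleGroup H ν →* unitary (V →L[ℂ] V)}
    (hσ : Continuous fun k => (σ k : V →L[ℂ] V))
    {L : H ⧸ littleGroup H ν → H} (hLc : Continuous L)
    (hL : ∀ q, (L q : H ⧸ littleGroup H ν) = q) :
    HermitianGBundle (baseAction hNH ν) V where
  metric _ := formOf (1 : V →L[ℂ] V)
  metric_symm _ v w := by simp [formOf_apply]
  metric_pos _ v hv := by
    rw [formOf_apply]
    exact (re_inner_self_pos (𝕜 := ℂ)).2 hv
  continuous_metric := by
    simp only [formOf_apply, one_apply_eq_self]
    fun_prop
  act := MonoidHom.toHomPerm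
    { toFun := fun s p => (hPart hNH s • p.1,
        (charTwist ν (nPart hNH s) (hPart hNH s • p.1) : ℂ) •
          (σ (wigner hL (hPart hNH s) p.1) : V →L[ℂ] V) p.2)
      map_one' := by
        funext p
        rw [(parts_one hNH).1, (parts_one hNH).2]
        refine Prod.ext (one_smul _ _) ?_
        change _ = p.2
        simp [charTwist_one, wigner_one]
      map_mul' := fun s t => by
        funext p
        rw [(parts_mul hNH s t).1, (parts_mul hNH s t).2]
        refine Prod.ext (mul_smul _ _ _) ?_
        change _ = (charTwist ν (nPart hNH s) (hPart hNH s • hPart hNH t • p.1) : ℂ) •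
          (σ (wigner hL (hPart hNH s) (hPart hNH t • p.1)) : V →L[ℂ] V)
            ((charTwist ν (nPart hNH t) (hPart hNH t • p.1) : ℂ) •
              (σ (wigner hL (hPart hNH t) p.1) : V →L[ℂ] V) p.2)
        rw [charTwist_mul, wigner_mul, mul_smul (hPart hNH s) (hPart hNH t) p.1, charTwist_conj,
          map_smul, map_mul, Submonoid.coe_mul, mul_apply_eq_comp, Circle.coe_mul, mul_smul] }
  act_fst _ _ := rfl
  act_add s x v w := by
    change _ • _ = _ • _ + _ • _
    rw [map_add, smul_add]
  act_smul s x c v := by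
    change _ • _ = c • _ • _
    rw [map_smul, smul_comm]
  act_isometry s q v w := by
    change formOf (1 : V →L[ℂ] V) ((_ : ℂ) • (σ _ : V →L[ℂ] V) v) ((_ : ℂ) • (σ _ : V →L[ℂ] V) w)
      = _
    simp only [formOf_apply, one_apply_eq_self]
    rw [← circleUnitary_apply, ← circleUnitary_apply, unitary_inner, unitary_inner]
  continuous_act s := by
    have h1 : Continuous fun p : (H ⧸ littleGroup H ν) × V => hPart hNH s • p.1 :=
      (continuous_const_smul _).comp continuous_fst
    have h2 : Continuous fun p : (H ⧸ littleGroup H ν) × V =>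
        (charTwist ν (nPart hNH s) (hPart hNH s • p.1) : ℂ) :=
      continuous_subtype_val.comp ((continuous_charTwist hν _).comp h1)
    have h3 : Continuous fun p : (H ⧸ littleGroup H ν) × V => wigner hL (hPart hNH s) p.1 := by
      refine Continuous.subtype_mk ?_ _
      exact ((hLc.comp h1).inv.mul continuous_const).mul (hLc.comp continuous_fst)
    exact h1.prodMk (h2.smul ((hσ.comp h3).clm_apply continuous_snd))

theorem boostingBundle_act (hNH : Function.Bijective (mulMap N H)) (hν : Continuous ν)
    {σ : littleGroup H ν →* unitary (V →L[ℂ] V)}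
    (hσ : Continuous fun k => (σ k : V →L[ℂ] V))
    {L : H ⧸ littleGroup H ν → H} (hLc : Continuous L)
    (hL : ∀ q, (L q : H ⧸ littleGroup H ν) = q) (n : N) (h y : H) (v : V) :
    (boostingBundle hNH hν hσ hLc hL).act (n * h) ((y : H ⧸ littleGroup H ν), v)
      = (((h * y : H) : H ⧸ littleGroup H ν),
          (ν (MulAut.conjNormal ((h * y : H) : G)⁻¹ n) : ℂ) •
            (σ (wigner hL h (y : H ⧸ littleGroup H ν)) : V →L[ℂ] V) v) := by
  obtain ⟨h1, h2⟩ := parts_eq hNH (g := n * h) rfl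
  change (hPart hNH (n * h) • (y : H ⧸ littleGroup H ν),
    (charTwist ν (nPart hNH (n * h)) (hPart hNH (n * h) • (y : H ⧸ littleGroup H ν)) : ℂ) •
      (σ (wigner hL (hPart hNH (n * h)) (y : H ⧸ littleGroup H ν)) : V →L[ℂ] V) v) = _
  rw [h1, h2]
  rfl

/-- The map `α : (xH_ν, v) ↦ (xH_ν, Φ(L(xH_ν)⁻¹) v)`. -/
def boostMap (Φ : H →* (V →L[ℂ] V)ˣ) (L : H ⧸ littleGroup H ν → H) :
    (H ⧸ littleGroup H ν) × V → (H ⧸ littleGroup H ν) × V :=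
  fun p => (p.1, (Φ (L p.1)⁻¹ : V →L[ℂ] V) p.2)

end Boosting

section InvariantMeasure

variable {ν : N →* Circle}

theorem cosetMap_baseAction (hNH : Function.Bijective (mulMap N H)) (g : G)
    (q : H ⧸ littleGroup H ν) : cosetMap H ν (baseAction hNH ν g q) = g • cosetMap H ν q := by
  obtain ⟨y, rfl⟩ := QuotientGroup.mk_surjective q
  change ((hPart hNH g * y : G) : G ⧸ isotropy ν) = ((g * y : G) : G ⧸ isotropy ν)
  rw [QuotientGroup.eq]
  have : ((hPart hNH g : G) * y)⁻¹ * ((nPart hNH g : G) * hPart hNH g * y)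
      = (MulAut.conjNormal ((hPart hNH g : G) * y)⁻¹ (nPart hNH g) : N) := by
    simp only [MulAut.conjNormal_apply]
    group
  rw [nPart_mul_hPart] at this
  rw [this]
  exact coe_mem_isotropy ν _

variable [MeasurableSpace G]

theorem measurable_cosetMap : Measurable (cosetMap H ν) :=
  QuotientGroup.measurable_from_quotient.2
    (QuotientGroup.measurable_coe.comp measurable_subtype_coe)

variable [MeasurableMul G]

/-- An `H`-invariant measure on `H/H_ν` is invariant under the action of `G`. -/
theorem measurePreserving_baseAction (hNH : Function.Bijective (mulMap N H))
    (μ : Measure (H ⧸ littleGroup H ν)) [SMulInvariantMeasure H (H ⧸ littleGroup H ν) μ] (g : G) :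
    MeasurePreserving (baseAction hNH ν g) μ μ := by
  have hm : Measurable (baseAction hNH ν g) := by
    refine QuotientGroup.measurable_from_quotient.2 ?_
    have : Measurable fun y : H => hPart hNH g * y :=
      ((measurable_const_mul (hPart hNH g : G)).comp measurable_subtype_coe).subtype_mk
    exact QuotientGroup.measurable_coe.comp this
  refine ⟨hm, Measure.ext fun s hs => ?_⟩
  rw [Measure.map_apply hm hs]
  exact SMulInvariantMeasure.measure_preimage_smul (hPart hNH g) hs

/-- The measure on `G/G_ν` corresponding to `μ` under `H/H_ν ≅ G/G_ν` is `G`-invariant. -/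
theorem measurePreserving_cosetMap (hNH : Function.Bijective (mulMap N H))
    (μ : Measure (H ⧸ littleGroup H ν)) [SMulInvariantMeasure H (H ⧸ littleGroup H ν) μ] (g : G) :
    MeasurePreserving (fun q : G ⧸ isotropy ν => g • q) (μ.map (cosetMap H ν))
      (μ.map (cosetMap H ν)) := by
  have hm : Measurable fun q : G ⧸ isotropy ν => g • q := by
    refine QuotientGroup.measurable_from_quotient.2 ?_
    exact QuotientGroup.measurable_coe.comp (measurable_const_mul g)
  refine ⟨hm, ?_⟩
  rw [Measure.map_map hm measurable_cosetMap]
  have : (fun q : G ⧸ isotropy ν => g • q) ∘ cosetMap H ν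
      = cosetMap H ν ∘ baseAction hNH ν g := by
    funext q
    exact (cosetMap_baseAction hNH g q).symm
  have hb := measurePreserving_baseAction hNH μ g
  rw [this, ← Measure.map_map measurable_cosetMap hb.measurable, hb.map_eq]

end InvariantMeasure

end Semidirect

end

/-! The global section `L` makes every construction explicit. A quantity on H/H_ν defined through a
representative may be evaluated at the representative L(q), and then it is visibly a composite of
smooth maps: the action of h is q ↦ π(h L(q)), the character twist is ν(L(q)⁻¹ n L(q)), and the
perception metric is ⟨Φ(L(q))⁻¹ v, Φ(L(q))⁻¹ w⟩ (`contMDiff_quotient_smul`, `contMDiff_charTwist`,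
`formOf_perceptionOp`). The last formula says that α turns the perception metric into the constant
one. Equivariance of α is the identity Φ(L(hq))⁻¹ Φ(h) = Φ(W_L(h,q)) Φ(L(q))⁻¹, in which Φ agrees
with σ on the Wigner element (`isIso_boostMap`). Composition with α is then a unitary equivalence of
U with U_L.

For the induced representation, every g in G is uniquely L(q) k with k in G_ν, where q is the coset
of the H-part of g. A covariant function f is therefore determined by f ∘ L, and every Borel ψ on
H/H_ν extends to a covariant Borel function. Restriction f ↦ f ∘ L preserves norms because the
measure on G/G_ν is the image of μ. It intertwines Ind with U_L because, for s = nh, s⁻¹ L(q) =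
L(h⁻¹q) (m W)⁻¹ with m = L(q)⁻¹ n L(q) in N and W = W_L(h, h⁻¹q) in H_ν
(`IsCovariant.inv_mul_section`).

The analytic statements are proved on the boosting bundle, whose metric is constant: its section
space is L²(μ; V), hence complete, and equals L²(μ) ⊗ V for finite-dimensional V (`l2SectionEquiv`,
`lpTensorEquiv`). Strong continuity of U_L combines continuity of translations in L² with dominated
convergence in the fibre (`stronglyContinuous_rep`). Completeness and strong continuity pass to U
and Ind along the unitary equivalences. -/

/-! ### Isometries out of a pre-Hilbert space and its separated space -/

section Separated

variable {G X Y Z : Type*} [Group G] [SeminormedAddCommGroup X] [InnerProductSpace ℂ X]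
  [NormedAddCommGroup Y] [InnerProductSpace ℂ Y] [NormedAddCommGroup Z] [InnerProductSpace ℂ Z]

/-- A surjective linear isometry from a pre-Hilbert space onto a separated one induces a unitary
map on the separated quotient. -/
noncomputable def SeparationQuotient.liftIsometryEquiv (A : X →ₗᵢ[ℂ] Y)
    (hA : Function.Surjective A) : SeparationQuotient X ≃ₗᵢ[ℂ] Y :=
  LinearIsometryEquiv.ofSurjective
    { toLinearMap := (SeparationQuotient.liftCLM A.toContinuousLinearMap fun _ _ h =>
        (h.map A.continuous).eq).toLinearMap
      norm_map' := fun f => by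
        obtain ⟨f, rfl⟩ := SeparationQuotient.surjective_mk f
        exact (A.norm_map f).trans (SeparationQuotient.norm_mk f).symm }
    fun y => by
      obtain ⟨f, rfl⟩ := hA y
      exact ⟨SeparationQuotient.mk f, rfl⟩

/-- The quotient map onto the separated space as a linear isometry. -/
noncomputable def SeparationQuotient.mkIsometry (X : Type*) [SeminormedAddCommGroup X]
    [InnerProductSpace ℂ X] : X →ₗᵢ[ℂ] SeparationQuotient X :=
  ⟨(SeparationQuotient.mkCLM ℂ X).toLinearMap, SeparationQuotient.norm_mk⟩

theorem UnitarilyEquivalent.symm {π₁ : G →* (Y ≃ₗᵢ[ℂ] Y)} {π₂ : G →* (Z ≃ₗᵢ[ℂ] Z)}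
    (h : UnitarilyEquivalent π₁ π₂) : UnitarilyEquivalent π₂ π₁ := by
  obtain ⟨T, hT⟩ := h
  refine ⟨T.symm, fun s f => ?_⟩
  rw [LinearIsometryEquiv.symm_apply_eq, hT, LinearIsometryEquiv.apply_symm_apply]

theorem UnitarilyEquivalent.trans {W : Type*} [NormedAddCommGroup W] [InnerProductSpace ℂ W]
    {π₁ : G →* (Y ≃ₗᵢ[ℂ] Y)} {π₂ : G →* (Z ≃ₗᵢ[ℂ] Z)} {π₃ : G →* (W ≃ₗᵢ[ℂ] W)}
    (h : UnitarilyEquivalent π₁ π₂) (h' : UnitarilyEquivalent π₂ π₃) :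
    UnitarilyEquivalent π₁ π₃ := by
  obtain ⟨T, hT⟩ := h
  obtain ⟨S, hS⟩ := h'
  exact ⟨T.trans S, fun s f => by simp [hT, hS]⟩

/-- An isometry induces the topology of its source, so continuity of an orbit map can be tested
after applying the intertwiner. This reduces strong continuity of U and Ind to that of U_L. -/
theorem UnitarilyEquivalent.stronglyContinuous [TopologicalSpace G] {π₁ : G →* (Y ≃ₗᵢ[ℂ] Y)}
    {π₂ : G →* (Z ≃ₗᵢ[ℂ] Z)} (h : UnitarilyEquivalent π₁ π₂) (h₂ : StronglyContinuous π₂) :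
    StronglyContinuous π₁ := by
  obtain ⟨T, hT⟩ := h
  intro f
  refine T.isometry.isUniformInducing.isInducing.continuous_iff.2 ?_
  exact (h₂ (T f)).congr fun s => (hT s f).symm

theorem UnitarilyEquivalent.completeSpace {π₁ : G →* (Y ≃ₗᵢ[ℂ] Y)}
    {π₂ : G →* (Z ≃ₗᵢ[ℂ] Z)} (h : UnitarilyEquivalent π₁ π₂) [CompleteSpace Z] :
    CompleteSpace Y := by
  obtain ⟨T, -⟩ := h
  exact T.toIsometryEquiv.completeSpace

end Separated

/-! ### `L²(μ) ⊗ V` for finite-dimensional `V` -/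

section Tensor

variable {M V : Type*} [MeasurableSpace M] (μ : Measure M) [NormedAddCommGroup V]
  [InnerProductSpace ℂ V]

/-- The map `L²(μ) ⊗ V → L²(μ; V)`, `f ⊗ v ↦ f(·) v`. -/
noncomputable def lpTensor : Lp ℂ 2 μ ⊗[ℂ] V →ₗ[ℂ] Lp V 2 μ :=
  TensorProduct.lift <| LinearMap.mk₂ ℂ
    (fun f v => (ContinuousLinearMap.toSpanSingleton ℂ v).compLp f)
    (fun f g v => ((ContinuousLinearMap.toSpanSingleton ℂ v).compLpL 2 μ).map_add f g)
    (fun c f v => ((ContinuousLinearMap.toSpanSingleton ℂ v).compLpL 2 μ).map_smul c f)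
    (fun f v w => by
      rw [ContinuousLinearMap.toSpanSingleton_add, ContinuousLinearMap.add_compLp])
    (fun c f v => by
      rw [ContinuousLinearMap.toSpanSingleton_smul, ContinuousLinearMap.smul_compLp])

theorem coeFn_lpTensor_tmul (f : Lp ℂ 2 μ) (v : V) :
    lpTensor μ (f ⊗ₜ[ℂ] v) =ᵐ[μ] fun x => f x • v := by
  filter_upwards [(ContinuousLinearMap.toSpanSingleton ℂ v).coeFn_compLp f] with x hx
  exact hx

/-- Both sides are sesquilinear, so pure tensors suffice; there the pointwise product ⟨f(x)v, g(x)w⟩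
factors and the constant ⟨v, w⟩ leaves the integral. -/
theorem inner_lpTensor (x y : Lp ℂ 2 μ ⊗[ℂ] V) :
    inner ℂ (lpTensor μ x) (lpTensor μ y) = inner ℂ x y := by
  induction x with
  | zero => simp
  | add x x' hx hx' => rw [map_add, inner_add_left, inner_add_left, hx, hx']
  | tmul f v =>
    induction y with
    | zero => simp
    | add y y' hy hy' => rw [map_add, inner_add_right, inner_add_right, hy, hy']
    | tmul g w =>
      rw [TensorProduct.inner_tmul, L2.inner_def, L2.inner_def, ← integral_mul_const]
      refine integral_congr_ae ?_
      filter_upwards [coeFn_lpTensor_tmul μ f v, coeFn_lpTensor_tmul μ g w] with x hf hg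
      rw [hf, hg, inner_smul_left, inner_smul_right, RCLike.inner_apply]
      ring

/-- Expansion in an orthonormal basis b of V: F = ∑ ⟨b_i, F(·)⟩ b_i, a finite sum with coefficients
in L²(μ). Because the sum is finite, the algebraic tensor product needs no completion. -/
theorem surjective_lpTensor [FiniteDimensional ℂ V] :
    Function.Surjective (lpTensor (V := V) μ) := by
  intro F
  let b := stdOrthonormalBasis ℂ V
  refine ⟨∑ i, ((innerSL ℂ (b i)).compLp F) ⊗ₜ[ℂ] b i, ?_⟩
  rw [map_sum]
  refine Lp.ext ?_
  have h1 : ∀ i, ∀ᵐ x ∂μ, lpTensor μ (((innerSL ℂ (b i)).compLp F) ⊗ₜ[ℂ] b i) x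
      = inner ℂ (b i) (F x) • b i := fun i => by
    filter_upwards [coeFn_lpTensor_tmul μ ((innerSL ℂ (b i)).compLp F) (b i),
      (innerSL ℂ (b i)).coeFn_compLp F] with x hx hx'
    rw [hx, hx']
    rfl
  filter_upwards [ae_all_iff.2 h1, Lp.coeFn_fun_finsetSum (p := 2) (μ := μ) (Finset.univ)
    (fun i => lpTensor μ (((innerSL ℂ (b i)).compLp F) ⊗ₜ[ℂ] b i))] with x hx hs
  rw [hs]
  simp_rw [hx]
  exact b.sum_repr' (F x)

/-- The unitary isomorphism `L²(μ) ⊗ V ≃ L²(μ; V)` for a finite-dimensional Hilbert space `V`. -/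
noncomputable def lpTensorEquiv [FiniteDimensional ℂ V] :
    (Lp ℂ 2 μ ⊗[ℂ] V) ≃ₗᵢ[ℂ] Lp V 2 μ :=
  LinearIsometryEquiv.ofSurjective
    (LinearMap.isometryOfInner (lpTensor (V := V) μ) (inner_lpTensor μ)) (surjective_lpTensor μ)

theorem lpTensorEquiv_apply [FiniteDimensional ℂ V] (x : Lp ℂ 2 μ ⊗[ℂ] V) :
    lpTensorEquiv μ x = lpTensor μ x := rfl

end Tensor

theorem MeasureTheory.memLp_two_iff_lintegral {M V : Type*} [MeasurableSpace M]
    [NormedAddCommGroup V] [SecondCountableTopology V] [MeasurableSpace V] [BorelSpace V]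
    {f : M → V} {μ : Measure M} (hf : Measurable f) :
    MemLp f 2 μ ↔ ∫⁻ x, ‖f x‖ₑ ^ 2 ∂μ < ⊤ := by
  rw [MemLp, and_iff_right hf.aestronglyMeasurable,
    eLpNorm_lt_top_iff_lintegral_rpow_enorm_lt_top (by simp) (by simp)]
  simp

/-! ### Hermitian `G`-bundles with constant metric -/

namespace HermitianGBundle

variable {G M V : Type*} [Group G] [TopologicalSpace M]
  [NormedAddCommGroup V] [InnerProductSpace ℂ V] {l : G →* Equiv.Perm M}

theorem norm_act_of_metric_eq_inner {B : HermitianGBundle l V}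
    (hB : ∀ x v w, B.metric x v w = inner ℂ v w) (s : G) (x : M) (v : V) :
    ‖(B.act s (x, v)).2‖ = ‖v‖ := by
  have h := B.act_isometry s x v v
  rw [hB, hB, inner_self_eq_norm_sq_to_K, inner_self_eq_norm_sq_to_K] at h
  have h2 : ‖(B.act s (x, v)).2‖ ^ 2 = ‖v‖ ^ 2 := by exact_mod_cast h
  exact (sq_eq_sq₀ (norm_nonneg _) (norm_nonneg _)).1 h2

theorem act_sub (B : HermitianGBundle l V) (s : G) (x : M) (v w : V) :
    (B.act s (x, v - w)).2 = (B.act s (x, v)).2 - (B.act s (x, w)).2 := by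
  rw [eq_sub_iff_add_eq, ← B.act_add, sub_add_cancel]

/-- Translates the integrability condition defining `L2Pre` into the L² condition of
`memLp_two_iff_lintegral`. -/
theorem ofReal_metric_self {B : HermitianGBundle l V}
    (hB : ∀ x v w, B.metric x v w = inner ℂ v w) (x : M) (v : V) :
    ENNReal.ofReal (B.metric x v v).re = ‖v‖ₑ ^ 2 := by
  rw [hB, ← ofReal_norm, ← ENNReal.ofReal_pow (norm_nonneg _)]
  congr 1
  exact (norm_sq_eq_re_inner (𝕜 := ℂ) v).symm

variable [MeasurableSpace M] [OpensMeasurableSpace M] [FiniteDimensional ℂ V]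
  [MeasurableSpace V] [BorelSpace V]

theorem L2Pre.memLp {B : HermitianGBundle l V} {μ : Measure M}
    (hB : ∀ x v w, B.metric x v w = inner ℂ v w) (f : B.L2Pre μ) : MemLp f 2 μ := by
  have : ProperSpace V := FiniteDimensional.proper ℂ V
  have : SecondCountableTopology V := secondCountable_of_proper
  refine (memLp_two_iff_lintegral f.measurable).2 ?_
  simpa only [ofReal_metric_self hB] using f.lintegral_lt_top

/-- If the metric is the constant one, square-integrable sections are square-integrable `V`-valued
functions. -/
noncomputable def toLpIsometry {B : HermitianGBundle l V} (μ : Measure M)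
    (hB : ∀ x v w, B.metric x v w = inner ℂ v w) : B.L2Pre μ →ₗᵢ[ℂ] Lp V 2 μ :=
  LinearMap.isometryOfInner
    { toFun := fun f => (f.memLp hB).toLp f
      map_add' := fun f g => MemLp.toLp_add (f.memLp hB) (g.memLp hB)
      map_smul' := fun c f => MemLp.toLp_const_smul c (f.memLp hB) }
    fun f g => by
      rw [L2.inner_def]
      change _ = ∫ x, B.metric x (f x) (g x) ∂μ
      refine integral_congr_ae ?_
      filter_upwards [(f.memLp hB).coeFn_toLp, (g.memLp hB).coeFn_toLp] with x hf hg
      rw [hB, ← hf, ← hg]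
      rfl

theorem toLpIsometry_apply {B : HermitianGBundle l V} (μ : Measure M)
    (hB : ∀ x v w, B.metric x v w = inner ℂ v w) (f : B.L2Pre μ) :
    toLpIsometry μ hB f = (f.memLp hB).toLp f := rfl

theorem surjective_toLpIsometry {B : HermitianGBundle l V} (μ : Measure M)
    (hB : ∀ x v w, B.metric x v w = inner ℂ v w) :
    Function.Surjective (toLpIsometry μ hB) := by
  have : ProperSpace V := FiniteDimensional.proper ℂ V
  have : SecondCountableTopology V := secondCountable_of_proper
  intro F
  -- The chosen representative of a class in `Lp` is strongly measurable everywhere, so it is itself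
  -- a Borel section and no modification on a null set is needed.
  have hF := Lp.stronglyMeasurable F
  have hm : Measurable F := hF.measurable
  refine ⟨L2Pre.mk F hm ?_, ?_⟩
  · simpa only [ofReal_metric_self hB] using (memLp_two_iff_lintegral hm).1 (Lp.memLp F)
  · exact Lp.toLp_coeFn F (Lp.memLp F)

/-- The `L²`-section space of a bundle with constant metric is `L²(μ; V)`. -/
noncomputable def l2SectionEquiv {B : HermitianGBundle l V} (μ : Measure M)
    (hB : ∀ x v w, B.metric x v w = inner ℂ v w) : B.L2Section μ ≃ₗᵢ[ℂ] Lp V 2 μ :=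
  SeparationQuotient.liftIsometryEquiv (toLpIsometry μ hB) (surjective_toLpIsometry μ hB)

theorem l2SectionEquiv_toL2 {B : HermitianGBundle l V} {μ : Measure M}
    (hB : ∀ x v w, B.metric x v w = inner ℂ v w) (f : B.L2Pre μ) :
    l2SectionEquiv μ hB (B.toL2 μ f) = (f.memLp hB).toLp f := rfl

theorem completeSpace_l2Section {B : HermitianGBundle l V} (μ : Measure M)
    (hB : ∀ x v w, B.metric x v w = inner ℂ v w) : CompleteSpace (B.L2Section μ) :=
  (l2SectionEquiv μ hB).toIsometryEquiv.completeSpace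

theorem exists_tensorEquiv {B : HermitianGBundle l V} (μ : Measure M)
    (hB : ∀ x v w, B.metric x v w = inner ℂ v w) :
    ∃ S : (Lp ℂ 2 μ ⊗[ℂ] V) ≃ₗᵢ[ℂ] B.L2Section μ,
      ∀ (f : Lp ℂ 2 μ) (v : V), ∃ ψ : B.L2Pre μ,
        (∀ᵐ x ∂μ, ψ x = f x • v) ∧ S (f ⊗ₜ[ℂ] v) = B.toL2 μ ψ := by
  refine ⟨(lpTensorEquiv μ).trans (l2SectionEquiv μ hB).symm, fun f v => ?_⟩
  obtain ⟨ψ, hψ⟩ := surjective_toLpIsometry μ hB (lpTensor μ (f ⊗ₜ[ℂ] v))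
  refine ⟨ψ, ?_, ?_⟩
  · have h := (ψ.memLp hB).coeFn_toLp
    rw [← toLpIsometry_apply μ hB, hψ] at h
    filter_upwards [h, coeFn_lpTensor_tmul μ f v] with x h1 h2
    rw [← h1, h2]
  · rw [LinearIsometryEquiv.trans_apply, LinearIsometryEquiv.symm_apply_eq, l2SectionEquiv_toL2,
      lpTensorEquiv_apply, ← hψ]
    rfl

/-! ### Strong continuity for a constant metric -/

open Filter Topology in
/-- A jointly continuous action on a bundle with constant metric gives a strongly continuous
representation. -/
theorem stronglyContinuous_rep [TopologicalSpace G] [ContinuousInv G] [FirstCountableTopology G]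
    [R1Space M] [BorelSpace M] {B : HermitianGBundle l V} {μ : Measure M} [IsLocallyFiniteMeasure μ]
    [μ.InnerRegularCompactLTTop] (hB : ∀ x v w, B.metric x v w = inner ℂ v w)
    (hμ : ∀ s, MeasurePreserving (l s) μ μ) (hl : Continuous fun p : G × M => l p.1 p.2)
    (hact : Continuous fun p : G × (M × V) => B.act p.1 p.2) :
    StronglyContinuous (B.rep hμ) := by
  have : ProperSpace V := FiniteDimensional.proper ℂ V
  have : SecondCountableTopology V := secondCountable_of_proper
  intro F
  obtain ⟨f, rfl⟩ := SeparationQuotient.surjective_mk F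
  refine (l2SectionEquiv μ hB).isometry.isUniformInducing.isInducing.continuous_iff.2 ?_
  refine continuous_iff_continuousAt.2 fun s₀ => ?_
  change Tendsto (fun s => ((B.preRep hμ s f).memLp hB).toLp (B.preRep hμ s f)) (𝓝 s₀)
    (𝓝 (((B.preRep hμ s₀ f).memLp hB).toLp (B.preRep hμ s₀ f)))
  rw [Lp.tendsto_Lp_iff_tendsto_eLpNorm'']
  -- The translations l_s⁻¹ as points of C(M, M): continuity of composition in L² is available for
  -- families of measure-preserving maps that are continuous in the compact-open topology.
  let τ : G → C(M, M) := fun s => ⟨fun x => l s⁻¹ x,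
    hl.comp (continuous_const.prodMk continuous_id)⟩
  have hτ : Continuous τ :=
    ContinuousMap.continuous_of_continuous_uncurry _
      (hl.comp (f := fun p : G × M => (p.1⁻¹, p.2)) (by fun_prop))
  have hτμ : ∀ s, MeasurePreserving (τ s) μ μ := fun s => hμ s⁻¹
  have hτm : ∀ s, Measurable fun x => f (τ s x) := fun s => f.measurable.comp (hτμ s).measurable
  -- The fibre part of the action, landing over x: the translated section is x ↦ C s x (f (τ s x)),
  -- so s enters through the translation τ and through the fibre isometry C. The two dependences are
  -- treated separately.
  let C : G → M → V → V := fun s x v => (B.act s (τ s x, v)).2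
  have hC : ∀ s, Continuous fun p : M × V => C s p.1 p.2 := fun s =>
    (continuous_snd.comp (B.continuous_act s)).comp
      (((τ s).continuous.comp continuous_fst).prodMk continuous_snd)
  have hCm : ∀ (s : G) {g : M → V}, Measurable g → Measurable fun x => C s x (g x) :=
    fun s g hg => (hC s).measurable.comp (measurable_id.prodMk hg)
  have hrep : ∀ s x, B.preRep hμ s f x = C s x (f (τ s x)) := fun s x => by
    change (B.act s ((l s)⁻¹ x, f ((l s)⁻¹ x))).2 = (B.act s (l s⁻¹ x, f (l s⁻¹ x))).2
    rw [map_inv]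
  have hfL := f.memLp hB
  -- Dependence through τ: translation is continuous in L². Regularity of the measure enters here.
  have h1 : Tendsto (fun s => eLpNorm (fun x => f (τ s x) - f (τ s₀ x)) 2 μ) (𝓝 s₀) (𝓝 0) := by
    have h := (Continuous.compMeasurePreservingLp (f := fun _ : G => hfL.toLp f)
      continuous_const hτ hτμ (by simp)).tendsto s₀
    simp_rw [Lp.toLp_compMeasurePreserving] at h
    exact (Lp.tendsto_Lp_iff_tendsto_eLpNorm'' _ _ _ _).1 h
  -- Dependence through C, with the translate f ∘ τ s₀ held fixed: pointwise convergence is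
  -- continuity of the action at a single point, and since each C s x is isometric the squared
  -- difference is dominated by (2‖f (τ s₀ x)‖)².
  have h2 : Tendsto (fun s => eLpNorm (fun x => C s x (f (τ s₀ x)) - C s₀ x (f (τ s₀ x))) 2 μ)
      (𝓝 s₀) (𝓝 0) := by
    have hint : Tendsto (fun s => ∫⁻ x, ‖C s x (f (τ s₀ x)) - C s₀ x (f (τ s₀ x))‖ₑ ^ 2 ∂μ)
        (𝓝 s₀) (𝓝 (∫⁻ _, 0 ∂μ)) := by
      refine tendsto_lintegral_filter_of_dominated_convergence
        (fun x => (2 * ‖f (τ s₀ x)‖ₑ) ^ 2)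
        (Eventually.of_forall fun s =>
          ((hCm s (hτm s₀)).sub (hCm s₀ (hτm s₀))).enorm.pow_const 2)
        (Eventually.of_forall fun s => Eventually.of_forall fun x => ?_) ?_
        (Eventually.of_forall fun x => ?_)
      · gcongr
        refine enorm_sub_le.trans ?_
        have : ∀ s, ‖C s x (f (τ s₀ x))‖ₑ = ‖f (τ s₀ x)‖ₑ := fun s => by
          rw [← ofReal_norm, norm_act_of_metric_eq_inner hB, ofReal_norm]
        rw [this, this, two_mul]
      · simp_rw [mul_pow]
        rw [lintegral_const_mul' _ _ (by simp)]
        exact ENNReal.mul_ne_top (by simp)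
          ((memLp_two_iff_lintegral (hτm s₀)).1 (hfL.comp_measurePreserving (hτμ s₀))).ne
      · have hc : Continuous fun s => C s x (f (τ s₀ x)) := by
          have h0 : Continuous fun s => (s, (τ s x, f (τ s₀ x))) :=
            continuous_id.prodMk (((continuous_eval_const x).comp hτ).prodMk continuous_const)
          exact continuous_snd.comp (hact.comp h0)
        have h3 : Continuous fun s => ‖C s x (f (τ s₀ x)) - C s₀ x (f (τ s₀ x))‖ₑ ^ 2 :=
          (ENNReal.continuous_pow 2).comp (hc.sub continuous_const).enorm
        simpa using h3.tendsto s₀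
    -- The limit above is for the square of the norm; the continuous map t ↦ t^(1/2) turns it into
    -- one for the norm.
    have h3 := (ENNReal.continuous_rpow_const (y := 1 / 2)).tendsto (∫⁻ _ : M, 0 ∂μ)
    refine (h3.comp hint).congr' (Eventually.of_forall fun s => ?_) |>.trans ?_
    · rw [eLpNorm_eq_lintegral_rpow_enorm_toReal (by simp) (by simp)]
      simp
    · simp
  have h12 := h1.add h2
  rw [add_zero] at h12
  refine tendsto_of_tendsto_of_tendsto_of_le_of_le tendsto_const_nhds h12
    (fun _ => zero_le) fun s => ?_
  -- Insert C s applied to f ∘ τ s₀. The first summand has the pointwise norm of f ∘ τ s − f ∘ τ s₀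
  -- by isometry of C s, so it is governed by `h1`; the second is exactly the function in `h2`.
  have hs : (⇑(B.preRep hμ s f) - ⇑(B.preRep hμ s₀ f) : M → V)
      = (fun x => C s x (f (τ s x) - f (τ s₀ x)))
        + fun x => C s x (f (τ s₀ x)) - C s₀ x (f (τ s₀ x)) := by
    funext x
    simp only [Pi.sub_apply, Pi.add_apply, hrep]
    change _ = (B.act s (τ s x, _)).2 + _
    rw [B.act_sub]
    change _ = C s x _ - C s x _ + _
    abel
  change eLpNorm (⇑(B.preRep hμ s f) - ⇑(B.preRep hμ s₀ f)) 2 μ ≤ _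
  rw [hs]
  refine (eLpNorm_add_le (hCm s ((hτm s).sub (hτm s₀))).aestronglyMeasurable
    ((hCm s (hτm s₀)).sub (hCm s₀ (hτm s₀))).aestronglyMeasurable (by simp)).trans ?_
  exact add_le_add (eLpNorm_congr_norm_ae (Eventually.of_forall fun x =>
    norm_act_of_metric_eq_inner hB s _ _)).le le_rfl

end HermitianGBundle

/-! ### Smoothness of the two bundles -/

section Smooth

/-- The metric may be evaluated at any representative of the coset. Choosing L(q) gives both the
smoothness of the metric and the isometry property of α. -/
theorem formOf_perceptionOp {G V : Type*} [Group G] {N H : Subgroup G} [N.Normal]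
    [NormedAddCommGroup V] [InnerProductSpace ℂ V] [CompleteSpace V] {ν : N →* Circle}
    {L : H ⧸ littleGroup H ν → H} {σ : littleGroup H ν →* unitary (V →L[ℂ] V)}
    {Φ : H →* (V →L[ℂ] V)ˣ}
    (hΦσ : ∀ k : littleGroup H ν, (Φ k : V →L[ℂ] V) = σ k)
    (hL : ∀ q, (L q : H ⧸ littleGroup H ν) = q) (q : H ⧸ littleGroup H ν) (v w : V) :
    formOf (perceptionOp hΦσ q) v w
      = inner ℂ ((Φ (L q)⁻¹ : V →L[ℂ] V) v) ((Φ (L q)⁻¹ : V →L[ℂ] V) w) := by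
  conv_lhs => rw [← hL q]
  exact formOf_perceptionOp_mk hΦσ (L q) v w

/-- The manifolds are real while the operators are complex-linear: evaluation is a bounded bilinear
map over ℂ, hence smooth over ℂ, and scalars are then restricted to ℝ. -/
theorem ContMDiff.complex_clm_apply {V W E' H' M' : Type*}
    [NormedAddCommGroup V] [NormedSpace ℂ V] [NormedAddCommGroup W] [NormedSpace ℂ W]
    [NormedAddCommGroup E'] [NormedSpace ℝ E'] [TopologicalSpace H'] {J : ModelWithCorners ℝ E' H'}
    [TopologicalSpace M'] [ChartedSpace H' M'] {n : ℕ∞ω} {A : M' → V →L[ℂ] W} {f : M' → V}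
    (hA : ContMDiff J 𝓘(ℝ, V →L[ℂ] W) n A) (hf : ContMDiff J 𝓘(ℝ, V) n f) :
    ContMDiff J 𝓘(ℝ, W) n fun x => A x (f x) := by
  have h : ContDiff ℝ n fun p : (V →L[ℂ] W) × V => p.1 p.2 :=
    (isBoundedBilinearMap_apply (𝕜 := ℂ) (E := V) (F := W)).contDiff.restrict_scalars ℝ
  exact h.comp_contMDiff (hA.prodMk_space hf)

theorem Circle.contMDiff_coe {n : ℕ∞ω} : ContMDiff (𝓡 1) 𝓘(ℝ, ℂ) n fun z : Circle => (z : ℂ) :=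
  have : Fact (Module.finrank ℝ ℂ = 1 + 1) := finrank_real_complex_fact'
  contMDiff_coe_sphere (E := ℂ)

variable {EG EN EH EM : Type*}
  [NormedAddCommGroup EG] [NormedSpace ℝ EG] [NormedAddCommGroup EN] [NormedSpace ℝ EN]
  [NormedAddCommGroup EH] [NormedSpace ℝ EH] [NormedAddCommGroup EM] [NormedSpace ℝ EM]
  {G : Type*} [Group G] [TopologicalSpace G] [ChartedSpace EG G]
  {N H : Subgroup G} [ChartedSpace EN N] [ChartedSpace EH H]
  {E' H' M' : Type*} [NormedAddCommGroup E'] [NormedSpace ℝ E'] [TopologicalSpace H']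
  {J : ModelWithCorners ℝ E' H'} [TopologicalSpace M'] [ChartedSpace H' M']

/-! ### Smooth coordinates on N ⋉ H -/

namespace IsLieSemidirect

/-- The inclusion is n ↦ (n, 1) ↦ n · 1. The smooth structures of N and H are tied to that of G only
through the product diffeomorphism, so smoothness of both inclusions is extracted from it. -/
theorem contMDiff_coe_left (hG : IsLieSemidirect (EG := EG) (EN := EN) (EH := EH) N H) :
    ContMDiff 𝓘(ℝ, EN) 𝓘(ℝ, EG) ∞ ((↑) : N → G) := by
  obtain ⟨e, he⟩ := hG.diffeo
  have h := e.contMDiff.comp ((contMDiff_id (I := 𝓘(ℝ, EN)) (M := N)).prodMk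
    (contMDiff_const (I' := 𝓘(ℝ, EH)) (c := (1 : H))))
  refine h.congr fun n => ?_
  simp [he, mulMap]

theorem contMDiff_coe_right (hG : IsLieSemidirect (EG := EG) (EN := EN) (EH := EH) N H) :
    ContMDiff 𝓘(ℝ, EH) 𝓘(ℝ, EG) ∞ ((↑) : H → G) := by
  obtain ⟨e, he⟩ := hG.diffeo
  have h := e.contMDiff.comp ((contMDiff_const (I' := 𝓘(ℝ, EN)) (c := (1 : N))).prodMk
    (contMDiff_id (I := 𝓘(ℝ, EH)) (M := H)))
  refine h.congr fun n => ?_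
  simp [he, mulMap]

theorem contMDiff_parts (hG : IsLieSemidirect (EG := EG) (EN := EN) (EH := EH) N H) :
    ContMDiff 𝓘(ℝ, EG) 𝓘(ℝ, EN) ∞ (nPart hG.bijective) ∧
      ContMDiff 𝓘(ℝ, EG) 𝓘(ℝ, EH) ∞ (hPart hG.bijective) := by
  obtain ⟨e, he⟩ := hG.diffeo
  have h : ∀ g, e.symm g = (nPart hG.bijective g, hPart hG.bijective g) := fun g => by
    have : mulMap N H (e.symm g) = g := by rw [← he]; exact e.apply_symm_apply g
    obtain ⟨h1, h2⟩ := parts_eq hG.bijective this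
    rw [h1, h2]
  exact ⟨(contMDiff_fst.comp e.symm.contMDiff).congr fun g => by simp [h],
    (contMDiff_snd.comp e.symm.contMDiff).congr fun g => by simp [h]⟩

/-- The conjugate is smooth as a G-valued map. It takes values in N, where the smooth projection
`nPart` is the identity, and composing with that projection makes it smooth into N. -/
theorem contMDiff_conjNormal [LieGroup 𝓘(ℝ, EG) ∞ G] [N.Normal]
    (hG : IsLieSemidirect (EG := EG) (EN := EN) (EH := EH) N H) {f : M' → H} {g : M' → N}
    (hf : ContMDiff J 𝓘(ℝ, EH) ∞ f) (hg : ContMDiff J 𝓘(ℝ, EN) ∞ g) :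
    ContMDiff J 𝓘(ℝ, EN) ∞ fun x => MulAut.conjNormal (f x : G)⁻¹ (g x) := by
  have hf' := hG.contMDiff_coe_right.comp hf
  have h := hG.contMDiff_parts.1.comp ((hf'.inv.mul (hG.contMDiff_coe_left.comp hg)).mul hf')
  refine h.congr fun x => ?_
  refine (parts_eq (h := 1) hG.bijective ?_).1.symm
  simp

end IsLieSemidirect

variable [N.Normal] {ν : N →* Circle}
  [ChartedSpace EM (H ⧸ littleGroup H ν)] {L : H ⧸ littleGroup H ν → H}

/-- At the representative L(q) the twist is ν(L(q)⁻¹ n L(q)), a composite of smooth maps jointly in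
n and q. -/
theorem contMDiff_charTwist [LieGroup 𝓘(ℝ, EG) ∞ G]
    (hG : IsLieSemidirect (EG := EG) (EN := EN) (EH := EH) N H)
    (hν : ContMDiff 𝓘(ℝ, EN) (𝓡 1) ∞ ν) (hLs : ContMDiff 𝓘(ℝ, EM) 𝓘(ℝ, EH) ∞ L)
    (hL : ∀ q, (L q : H ⧸ littleGroup H ν) = q) {f : M' → N} {g : M' → H ⧸ littleGroup H ν}
    (hf : ContMDiff J 𝓘(ℝ, EN) ∞ f) (hg : ContMDiff J 𝓘(ℝ, EM) ∞ g) :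
    ContMDiff J 𝓘(ℝ, ℂ) ∞ fun x => (charTwist ν (f x) (g x) : ℂ) := by
  have h := Circle.contMDiff_coe.comp (hν.comp (hG.contMDiff_conjNormal (hLs.comp hg) hf))
  refine h.congr fun x => ?_
  conv_lhs => rw [← hL (g x)]
  rfl

variable [LieGroup 𝓘(ℝ, EH) ∞ H]

/-- Lift through the section: h • q = π(h L(q)). -/
theorem contMDiff_quotient_smul (hπ : ContMDiff 𝓘(ℝ, EH) 𝓘(ℝ, EM) ∞
      (QuotientGroup.mk : H → H ⧸ littleGroup H ν))
    (hLs : ContMDiff 𝓘(ℝ, EM) 𝓘(ℝ, EH) ∞ L)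
    (hL : ∀ q, (L q : H ⧸ littleGroup H ν) = q) {f : M' → H} {g : M' → H ⧸ littleGroup H ν}
    (hf : ContMDiff J 𝓘(ℝ, EH) ∞ f) (hg : ContMDiff J 𝓘(ℝ, EM) ∞ g) :
    ContMDiff J 𝓘(ℝ, EM) ∞ fun x => f x • g x := by
  have h := hπ.comp (hf.mul (hLs.comp hg))
  refine h.congr fun x => ?_
  conv_lhs => rw [← hL (g x)]
  rfl

theorem contMDiff_baseAction (hG : IsLieSemidirect (EG := EG) (EN := EN) (EH := EH) N H)
    (hπ : ContMDiff 𝓘(ℝ, EH) 𝓘(ℝ, EM) ∞ (QuotientGroup.mk : H → H ⧸ littleGroup H ν))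
    (hLs : ContMDiff 𝓘(ℝ, EM) 𝓘(ℝ, EH) ∞ L) (hL : ∀ q, (L q : H ⧸ littleGroup H ν) = q) :
    ContMDiff (𝓘(ℝ, EG).prod 𝓘(ℝ, EM)) 𝓘(ℝ, EM) ∞
      fun p : G × (H ⧸ littleGroup H ν) => baseAction hG.bijective ν p.1 p.2 :=
  contMDiff_quotient_smul hπ hLs hL (hG.contMDiff_parts.2.comp contMDiff_fst) contMDiff_snd

variable [IsTopologicalGroup G] {V : Type*} [NormedAddCommGroup V] [InnerProductSpace ℂ V]
  [CompleteSpace V]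
  {σ : littleGroup H ν →* unitary (V →L[ℂ] V)} {Φ : H →* (V →L[ℂ] V)ˣ}

/-- On the fibre over q, α is the invertible operator Φ(L(q))⁻¹, smooth in q together with its
inverse Φ(L(q)). The perception metric is the pullback of ⟨·,·⟩ under precisely this operator. -/
theorem isIso_boostMap (hG : IsLieSemidirect (EG := EG) (EN := EN) (EH := EH) N H)
    (hν : ContMDiff 𝓘(ℝ, EN) (𝓡 1) ∞ ν)
    (hσ : Continuous fun k => (σ k : V →L[ℂ] V))
    (hΦ : ContMDiff 𝓘(ℝ, EH) 𝓘(ℝ, V →L[ℂ] V) ∞ fun x => (Φ x : V →L[ℂ] V))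
    (hΦσ : ∀ k : littleGroup H ν, (Φ k : V →L[ℂ] V) = σ k)
    (hLs : ContMDiff 𝓘(ℝ, EM) 𝓘(ℝ, EH) ∞ L) (hL : ∀ q, (L q : H ⧸ littleGroup H ν) = q) :
    (perceptionBundle hG.bijective hν.continuous hΦ.continuous hΦσ).IsIso
      (boostingBundle hG.bijective hν.continuous hσ hLs.continuous hL) (boostMap Φ L)
      (EM := EM) where
  diffeo := by
    have hq : ContMDiff (𝓘(ℝ, EM).prod 𝓘(ℝ, V)) 𝓘(ℝ, EM) ∞
        fun p : (H ⧸ littleGroup H ν) × V => p.1 := contMDiff_fst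
    refine ⟨{ toFun := boostMap Φ L
              invFun := fun p => (p.1, (Φ (L p.1) : V →L[ℂ] V) p.2)
              left_inv := fun p => ?_
              right_inv := fun p => ?_
              contMDiff_toFun :=
                hq.prodMk ((hΦ.comp (hLs.comp hq).inv).complex_clm_apply contMDiff_snd)
              contMDiff_invFun :=
                hq.prodMk ((hΦ.comp (hLs.comp hq)).complex_clm_apply contMDiff_snd) }, rfl⟩
    · refine Prod.ext rfl ?_
      change (Φ (L p.1) : V →L[ℂ] V) ((Φ (L p.1)⁻¹ : V →L[ℂ] V) p.2) = p.2
      rw [← mul_apply_eq_comp, ← Units.val_mul, ← map_mul]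
      simp
    · refine Prod.ext rfl ?_
      change (Φ (L p.1)⁻¹ : V →L[ℂ] V) ((Φ (L p.1) : V →L[ℂ] V) p.2) = p.2
      rw [← mul_apply_eq_comp, ← Units.val_mul, ← map_mul]
      simp
  fst _ := rfl
  map_add x v w := map_add (Φ (L x)⁻¹ : V →L[ℂ] V) v w
  map_smul x c v := map_smul (Φ (L x)⁻¹ : V →L[ℂ] V) c v
  isometry x v w := (formOf_perceptionOp hΦσ hL x v w).symm
  equivariant s p := by
    refine Prod.ext rfl ?_
    change (Φ (L (hPart hG.bijective s • p.1))⁻¹ : V →L[ℂ] V)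
        ((_ : ℂ) • (Φ (hPart hG.bijective s) : V →L[ℂ] V) p.2)
      = (_ : ℂ) • (σ (wigner hL (hPart hG.bijective s) p.1) : V →L[ℂ] V)
        ((Φ (L p.1)⁻¹ : V →L[ℂ] V) p.2)
    rw [map_smul, ← hΦσ]
    congr 1
    -- The character factors coincide and have been cancelled. Both remaining operators are
    -- Φ(L(hq)⁻¹ h), since W_L(h, q) L(q)⁻¹ = L(hq)⁻¹ h.
    rw [← mul_apply_eq_comp, ← mul_apply_eq_comp, ← Units.val_mul, ← map_mul, ← Units.val_mul,
      ← map_mul]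
    simp [wigner]

variable [LieGroup 𝓘(ℝ, EG) ∞ G]

theorem isSmooth_perceptionBundle (hG : IsLieSemidirect (EG := EG) (EN := EN) (EH := EH) N H)
    (hν : ContMDiff 𝓘(ℝ, EN) (𝓡 1) ∞ ν)
    (hΦ : ContMDiff 𝓘(ℝ, EH) 𝓘(ℝ, V →L[ℂ] V) ∞ fun x => (Φ x : V →L[ℂ] V))
    (hΦσ : ∀ k : littleGroup H ν, (Φ k : V →L[ℂ] V) = σ k)
    (hπ : ContMDiff 𝓘(ℝ, EH) 𝓘(ℝ, EM) ∞ (QuotientGroup.mk : H → H ⧸ littleGroup H ν))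
    (hLs : ContMDiff 𝓘(ℝ, EM) 𝓘(ℝ, EH) ∞ L) (hL : ∀ q, (L q : H ⧸ littleGroup H ν) = q) :
    (perceptionBundle hG.bijective hν.continuous hΦ.continuous hΦσ).IsSmooth
      (EG := EG) (EM := EM) where
  base := contMDiff_baseAction hG hπ hLs hL
  metric := by
    have h1 : ContMDiff (𝓘(ℝ, EM).prod (𝓘(ℝ, V).prod 𝓘(ℝ, V))) 𝓘(ℝ, V →L[ℂ] V) ∞
        fun p : (H ⧸ littleGroup H ν) × V × V => (Φ (L p.1)⁻¹ : V →L[ℂ] V) :=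
      hΦ.comp (hLs.comp contMDiff_fst).inv
    have h2 := h1.complex_clm_apply (contMDiff_fst.comp contMDiff_snd)
    have h3 := h1.complex_clm_apply (contMDiff_snd.comp contMDiff_snd)
    have h4 := (contDiff_inner (𝕜 := ℂ) (E := V)).comp_contMDiff (h2.prodMk_space h3)
    exact h4.congr fun p => formOf_perceptionOp hΦσ hL p.1 p.2.1 p.2.2
  act := by
    have h0 := hG.contMDiff_parts.2.comp (contMDiff_fst (I := 𝓘(ℝ, EG))
      (J := 𝓘(ℝ, EM).prod 𝓘(ℝ, V)) (M := G) (N := (H ⧸ littleGroup H ν) × V))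
    have h1 := contMDiff_quotient_smul hπ hLs hL h0 (contMDiff_fst.comp contMDiff_snd)
    have h2 := contMDiff_charTwist hG hν hLs hL (hG.contMDiff_parts.1.comp contMDiff_fst) h1
    have h3 := (hΦ.comp h0).complex_clm_apply (contMDiff_snd.comp contMDiff_snd)
    exact h1.prodMk (contDiff_smul.comp_contMDiff (h2.prodMk_space h3))

theorem isSmooth_boostingBundle (hG : IsLieSemidirect (EG := EG) (EN := EN) (EH := EH) N H)
    (hν : ContMDiff 𝓘(ℝ, EN) (𝓡 1) ∞ ν)
    (hσ : Continuous fun k => (σ k : V →L[ℂ] V))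
    (hΦ : ContMDiff 𝓘(ℝ, EH) 𝓘(ℝ, V →L[ℂ] V) ∞ fun x => (Φ x : V →L[ℂ] V))
    (hΦσ : ∀ k : littleGroup H ν, (Φ k : V →L[ℂ] V) = σ k)
    (hπ : ContMDiff 𝓘(ℝ, EH) 𝓘(ℝ, EM) ∞ (QuotientGroup.mk : H → H ⧸ littleGroup H ν))
    (hLs : ContMDiff 𝓘(ℝ, EM) 𝓘(ℝ, EH) ∞ L) (hL : ∀ q, (L q : H ⧸ littleGroup H ν) = q) :
    (boostingBundle hG.bijective hν.continuous hσ hLs.continuous hL).IsSmooth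
      (EG := EG) (EM := EM) where
  base := contMDiff_baseAction hG hπ hLs hL
  metric := by
    have h2 : ContMDiff (𝓘(ℝ, EM).prod (𝓘(ℝ, V).prod 𝓘(ℝ, V))) 𝓘(ℝ, V) ∞
        fun p : (H ⧸ littleGroup H ν) × V × V => p.2.1 := contMDiff_fst.comp contMDiff_snd
    have h3 : ContMDiff (𝓘(ℝ, EM).prod (𝓘(ℝ, V).prod 𝓘(ℝ, V))) 𝓘(ℝ, V) ∞
        fun p : (H ⧸ littleGroup H ν) × V × V => p.2.2 := contMDiff_snd.comp contMDiff_snd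
    exact (contDiff_inner (𝕜 := ℂ) (E := V)).comp_contMDiff (h2.prodMk_space h3)
  act := by
    have h0 := hG.contMDiff_parts.2.comp (contMDiff_fst (I := 𝓘(ℝ, EG))
      (J := 𝓘(ℝ, EM).prod 𝓘(ℝ, V)) (M := G) (N := (H ⧸ littleGroup H ν) × V))
    have hq : ContMDiff (𝓘(ℝ, EG).prod (𝓘(ℝ, EM).prod 𝓘(ℝ, V))) 𝓘(ℝ, EM) ∞
        fun p : G × ((H ⧸ littleGroup H ν) × V) => p.2.1 := contMDiff_fst.comp contMDiff_snd
    have h1 := contMDiff_quotient_smul hπ hLs hL h0 hq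
    have h2 := contMDiff_charTwist hG hν hLs hL (hG.contMDiff_parts.1.comp contMDiff_fst) h1
    -- The Wigner element is treated as a smooth map into H, and σ is replaced by Φ on it; thus
    -- smoothness never requires a manifold structure on the little group.
    have hW := ((hLs.comp h1).inv.mul h0).mul (hLs.comp hq)
    have h3 := (hΦ.comp hW).complex_clm_apply (contMDiff_snd.comp contMDiff_snd)
    refine (h1.prodMk (contDiff_smul.comp_contMDiff (h2.prodMk_space h3))).congr fun p => ?_
    refine Prod.ext rfl ?_
    change _ • (σ (wigner hL (hPart hG.bijective p.1) p.2.1) : V →L[ℂ] V) p.2.2 = _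
    rw [← hΦσ]
    rfl

end Smooth

/-! ### The unitary equivalence defined by an isomorphism of Hermitian `G`-bundles -/

namespace HermitianGBundle

variable {G M V : Type*} [Group G] [TopologicalSpace M]
  [NormedAddCommGroup V] [InnerProductSpace ℂ V] {l : G →* Equiv.Perm M}
  {B B' : HermitianGBundle l V} {α : M × V → M × V}

theorem IsIso.continuous {EM : Type*} [NormedAddCommGroup EM] [NormedSpace ℝ EM]
    [ChartedSpace EM M] (h : B.IsIso B' α (EM := EM)) : Continuous α := by
  obtain ⟨e, rfl⟩ := h.diffeo
  exact e.continuous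

variable [MeasurableSpace M] [OpensMeasurableSpace M] [FiniteDimensional ℂ V]
  [MeasurableSpace V] [BorelSpace V]

theorem measurable_snd_comp {β : M × V → M × V} (hβ : Continuous β) {f : M → V}
    (hf : Measurable f) : Measurable fun x => (β (x, f x)).2 := by
  have : ProperSpace V := FiniteDimensional.proper ℂ V
  have : SecondCountableTopology V := secondCountable_of_proper
  exact (continuous_snd.comp hβ).measurable.comp (measurable_id.prodMk hf)

theorem norm_eq_of_metric_eq {μ : Measure M} {f : B.L2Pre μ} {g : B'.L2Pre μ}
    (h : ∀ x, B'.metric x (g x) (g x) = B.metric x (f x) (f x)) : ‖g‖ = ‖f‖ := by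
  change √(RCLike.re (∫ x, B'.metric x (g x) (g x) ∂μ))
    = √(RCLike.re (∫ x, B.metric x (f x) (f x) ∂μ))
  simp_rw [h]

namespace IsIso

variable {EM : Type*} [NormedAddCommGroup EM] [NormedSpace ℝ EM] [ChartedSpace EM M]

/-- Composition of square-integrable sections with an isomorphism of Hermitian `G`-bundles. -/
noncomputable def mapL2Pre (h : B.IsIso B' α (EM := EM)) (μ : Measure M) :
    B.L2Pre μ →ₗᵢ[ℂ] B'.L2Pre μ where
  toFun φ := L2Pre.mk (fun x => (α (x, φ x)).2) (measurable_snd_comp h.continuous φ.measurable)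
    (by simpa only [h.isometry] using φ.lintegral_lt_top)
  map_add' φ ψ := L2Pre.ext fun x => h.map_add x (φ x) (ψ x)
  map_smul' c φ := L2Pre.ext fun x => h.map_smul x c (φ x)
  norm_map' φ := norm_eq_of_metric_eq fun x => h.isometry x (φ x) (φ x)

theorem mapL2Pre_apply (h : B.IsIso B' α (EM := EM)) (μ : Measure M) (φ : B.L2Pre μ) (x : M) :
    (x, h.mapL2Pre μ φ x) = α (x, φ x) :=
  Prod.ext (h.fst (x, φ x)).symm rfl

theorem surjective_mapL2Pre (h : B.IsIso B' α (EM := EM)) (μ : Measure M) :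
    Function.Surjective (h.mapL2Pre μ) := by
  intro ψ
  obtain ⟨e, he⟩ := h.diffeo
  -- The inverse diffeomorphism also covers the identity of M, because α does; its second component
  -- therefore gives a preimage of each section.
  have h1 : ∀ x v, α (x, (e.symm (x, v)).2) = (x, v) := fun x v => by
    have h2 : α (e.symm (x, v)) = (x, v) := by rw [← he]; exact e.apply_symm_apply _
    have h3 : (e.symm (x, v)).1 = x := by rw [← h.fst, h2]
    rw [← h2]
    congr 1
    exact Prod.ext (by rw [h2, h3]) (by rw [h2])
  have h4 : ∀ x, B.metric x (e.symm (x, ψ x)).2 (e.symm (x, ψ x)).2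
      = B'.metric x (ψ x) (ψ x) := fun x => by rw [← h.isometry, h1]
  refine ⟨L2Pre.mk (fun x => (e.symm (x, ψ x)).2)
    (measurable_snd_comp e.symm.continuous ψ.measurable) ?_, L2Pre.ext fun x => ?_⟩
  · simpa only [h4] using ψ.lintegral_lt_top
  · change (α (x, (e.symm (x, ψ x)).2)).2 = _
    rw [h1]

/-- Pointwise equivariance of α. Because α covers the identity, the translation of the base point is
the same on both sides. -/
theorem mapL2Pre_preRep (h : B.IsIso B' α (EM := EM)) {μ : Measure M}
    (hμ : ∀ s, MeasurePreserving (l s) μ μ) (s : G) (φ : B.L2Pre μ) :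
    h.mapL2Pre μ (B.preRep hμ s φ) = B'.preRep hμ s (h.mapL2Pre μ φ) := by
  refine L2Pre.ext fun x => ?_
  have h1 := h.mapL2Pre_apply μ (B.preRep hμ s φ) x
  have h2 := B'.preRep_apply hμ s (h.mapL2Pre μ φ) x
  rw [B.preRep_apply, h.equivariant, ← h.mapL2Pre_apply, ← h2] at h1
  exact (Prod.ext_iff.1 h1).2

/-- An isomorphism of Hermitian `G`-bundles induces a unitary equivalence of the representations on
the `L²`-section spaces. -/
theorem exists_unitaryEquiv (h : B.IsIso B' α (EM := EM)) {μ : Measure M}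
    (hμ : ∀ s, MeasurePreserving (l s) μ μ) :
    ∃ T : B.L2Section μ ≃ₗᵢ[ℂ] B'.L2Section μ,
      (∀ φ : B.L2Pre μ, ∃ ψ : B'.L2Pre μ,
        (∀ x, (x, ψ x) = α (x, φ x)) ∧ T (B.toL2 μ φ) = B'.toL2 μ ψ) ∧
      ∀ s f, T (B.rep hμ s f) = B'.rep hμ s (T f) := by
  refine ⟨SeparationQuotient.liftIsometryEquiv
    ((SeparationQuotient.mkIsometry _).comp (h.mapL2Pre μ))
    (SeparationQuotient.surjective_mk.comp (h.surjective_mapL2Pre μ)),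
    fun φ => ⟨h.mapL2Pre μ φ, h.mapL2Pre_apply μ φ, rfl⟩, fun s f => ?_⟩
  obtain ⟨f, rfl⟩ := SeparationQuotient.surjective_mk f
  exact congrArg SeparationQuotient.mk (h.mapL2Pre_preRep hμ s f)

end IsIso

end HermitianGBundle

/-! ### The induced representation on sections of the boosting bundle -/

section InducedBoosting

variable {G : Type*} [Group G] {N H : Subgroup G} [N.Normal] {ν : N →* Circle}
  {V : Type*} [NormedAddCommGroup V] [InnerProductSpace ℂ V] [CompleteSpace V]
  {σ : littleGroup H ν →* unitary (V →L[ℂ] V)} {L : H ⧸ littleGroup H ν → H}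

/-- The section also supplies representatives for G/G_ν, which lets integrals over G/G_ν be written
in terms of f ∘ L. -/
theorem cosetMap_eq_mk (hL : ∀ q, (L q : H ⧸ littleGroup H ν) = q) (q : H ⧸ littleGroup H ν) :
    cosetMap H ν q = ((L q : G) : G ⧸ isotropy ν) := by
  conv_lhs => rw [← hL q]
  rfl

theorem nuSigma_mk (hNH : Function.Bijective (mulMap N H)) (n : N) (h : littleGroup H ν)
    (hg : (n : G) * (h : H) ∈ isotropy ν) (v : V) :
    (nuSigma hNH ν σ ⟨n * (h : H), hg⟩).1 v = (ν n : ℂ) • (σ h : V →L[ℂ] V) v := by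
  obtain ⟨h1, h2⟩ := parts_eq hNH (g := (n : G) * (h : H)) rfl
  have h3 : (⟨hPart hNH ((n : G) * (h : H)), hPart_mem_littleGroup hNH hg⟩ : littleGroup H ν) = h :=
    Subtype.ext h2
  change ((circleUnitary V (ν (nPart hNH ((n : G) * (h : H))))).1 *
    (σ ⟨hPart hNH ((n : G) * (h : H)), _⟩).1) v = _
  rw [h1, h3, mul_apply_eq_comp, circleUnitary_apply]

/-- The element `L(h H_ν)⁻¹ n h` of `G_ν` attached to `g = n h`. -/
noncomputable def isotropyPart (hNH : Function.Bijective (mulMap N H))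
    (hL : ∀ q, (L q : H ⧸ littleGroup H ν) = q) (g : G) : isotropy ν :=
  ⟨(L (hPart hNH g : H ⧸ littleGroup H ν) : G)⁻¹ * g, by
    -- Membership in G_ν means that L(hH_ν) and g = nh define the same coset of G_ν; this follows by
    -- applying equivariance of H/H_ν → G/G_ν at the base point.
    rw [← QuotientGroup.eq, ← cosetMap_eq_mk hL]
    have h := cosetMap_baseAction (ν := ν) hNH g ((1 : H) : H ⧸ littleGroup H ν)
    have h1 : baseAction hNH ν g ((1 : H) : H ⧸ littleGroup H ν)
        = (hPart hNH g : H ⧸ littleGroup H ν) := by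
      change ((hPart hNH g * 1 : H) : H ⧸ littleGroup H ν) = _
      rw [mul_one]
    rw [h1] at h
    rw [h]
    change ((g * ((1 : H) : G) : G) : G ⧸ isotropy ν) = _
    simp⟩

theorem mk_hPart_mul (hNH : Function.Bijective (mulMap N H)) (g : G) (k : isotropy ν) :
    ((hPart hNH (g * k) : H) : H ⧸ littleGroup H ν) = (hPart hNH g : H ⧸ littleGroup H ν) := by
  rw [(parts_mul hNH g k).2]
  exact QuotientGroup.mk_mul_of_mem _ (hPart_mem_littleGroup hNH k.2)

theorem isotropyPart_mul (hNH : Function.Bijective (mulMap N H))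
    (hL : ∀ q, (L q : H ⧸ littleGroup H ν) = q) (g : G) (k : isotropy ν) :
    isotropyPart hNH hL (g * k) = isotropyPart hNH hL g * k := by
  refine Subtype.ext ?_
  change (L (hPart hNH (g * k) : H ⧸ littleGroup H ν) : G)⁻¹ * (g * k) = _
  rw [mk_hPart_mul, ← mul_assoc]
  rfl

/-- The covariant function on `G` whose restriction along `L` is `ψ`. -/
noncomputable def covariantExtension (hNH : Function.Bijective (mulMap N H))
    (hL : ∀ q, (L q : H ⧸ littleGroup H ν) = q) (σ : littleGroup H ν →* unitary (V →L[ℂ] V))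
    (ψ : H ⧸ littleGroup H ν → V) (g : G) : V :=
  ((nuSigma hNH ν σ (isotropyPart hNH hL g))⁻¹ : unitary (V →L[ℂ] V)).1
    (ψ (hPart hNH g : H ⧸ littleGroup H ν))

/-- Right translation by k in G_ν leaves the coset of the H-part unchanged and multiplies the
isotropy part by k on the right; inverting the representation operator produces the factor νσ(k)⁻¹
on the left. -/
theorem isCovariant_covariantExtension (hNH : Function.Bijective (mulMap N H))
    (hL : ∀ q, (L q : H ⧸ littleGroup H ν) = q) (ψ : H ⧸ littleGroup H ν → V) :
    IsCovariant (nuSigma hNH ν σ) (covariantExtension hNH hL σ ψ) := by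
  intro g k
  rw [covariantExtension, covariantExtension, mk_hPart_mul, isotropyPart_mul, map_mul,
    mul_inv_rev, Submonoid.coe_mul, mul_apply_eq_comp]

theorem covariantExtension_section (hNH : Function.Bijective (mulMap N H))
    (hL : ∀ q, (L q : H ⧸ littleGroup H ν) = q) (ψ : H ⧸ littleGroup H ν → V)
    (q : H ⧸ littleGroup H ν) : covariantExtension hNH hL σ ψ (L q) = ψ q := by
  have h1 : hPart hNH (L q : G) = L q := (parts_eq hNH (n := 1) (by simp)).2
  have h2 : isotropyPart hNH hL (L q : G) = 1 := by
    refine Subtype.ext ?_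
    change (L (hPart hNH (L q : G) : H ⧸ littleGroup H ν) : G)⁻¹ * (L q : G) = 1
    rw [h1, hL, inv_mul_cancel]
  rw [covariantExtension, h1, h2, hL]
  simp

/-- The translate of a covariant function, restricted along the section `L`. -/
theorem IsCovariant.inv_mul_section (hNH : Function.Bijective (mulMap N H))
    (hL : ∀ q, (L q : H ⧸ littleGroup H ν) = q) {f : G → V}
    (hf : IsCovariant (nuSigma hNH ν σ) f) (s : G) (q : H ⧸ littleGroup H ν) :
    f (s⁻¹ * L q) = (charTwist ν (nPart hNH s) q : ℂ) •
      (σ (wigner hL (hPart hNH s) ((hPart hNH s)⁻¹ • q)) : V →L[ℂ] V)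
        (f (L ((hPart hNH s)⁻¹ • q))) := by
  set n := nPart hNH s with hn
  set h := hPart hNH s with hh
  set W := wigner hL h (h⁻¹ • q) with hW
  set m : N := MulAut.conjNormal (L q : G)⁻¹ n with hm
  have hmem : (m : G) * (W : H) ∈ isotropy ν := mul_mem (coe_mem_isotropy ν m) W.2
  have hWc : ((W : H) : G) = (L q : G)⁻¹ * h * L (h⁻¹ • q) := by
    rw [hW, wigner]
    simp
  -- Here m W = L(q)⁻¹ s L(h⁻¹q), so s⁻¹ L(q) is L(h⁻¹q) times the inverse of an element of G_ν
  -- already split into its N- and H_ν-parts. Covariance then yields ν(m) σ(W), the fibre factor of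
  -- the boosting action.
  have hs : s⁻¹ * (L q : G) = (L (h⁻¹ • q) : G) * ((⟨_, hmem⟩ : isotropy ν)⁻¹ : isotropy ν) := by
    change _ = _ * ((m : G) * ((W : H) : G))⁻¹
    rw [hWc, hm, ← nPart_mul_hPart hNH s, ← hn, ← hh]
    simp only [MulAut.conjNormal_apply]
    group
  rw [hs, hf, map_inv, inv_inv, nuSigma_mk, hm]
  congr 2
  conv_rhs => rw [← hL q]
  rfl

theorem IsCovariant.lintegral_section [MeasurableSpace G] [MeasurableSpace V] [BorelSpace V]
    {hNH : Function.Bijective (mulMap N H)}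
    (hL : ∀ q, (L q : H ⧸ littleGroup H ν) = q) {f : G → V}
    (hf : IsCovariant (nuSigma hNH ν σ) f) (hm : Measurable f)
    (μ : Measure (H ⧸ littleGroup H ν)) :
    ∫⁻ q : G ⧸ isotropy ν, ‖f q.out‖ₑ ^ 2 ∂μ.map (cosetMap H ν) = ∫⁻ q, ‖f (L q)‖ₑ ^ 2 ∂μ := by
  rw [lintegral_map ((hf.measurable_enorm hm).pow_const 2) measurable_cosetMap]
  refine lintegral_congr fun q => ?_
  rw [cosetMap_eq_mk hL, ← ofReal_norm, hf.norm_out, ofReal_norm]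

/-! ### The intertwiner f ↦ f ∘ L between Ind and U_L -/

variable [TopologicalSpace G]

theorem continuous_nuSigma (hNH : Function.Bijective (mulMap N H))
    (hn : Continuous (nPart hNH)) (hh : Continuous (hPart hNH)) (hν : Continuous ν)
    (hσ : Continuous fun k => (σ k : V →L[ℂ] V)) :
    Continuous fun k => (nuSigma hNH ν σ k : V →L[ℂ] V) := by
  have h1 : Continuous fun k : isotropy ν => (ν (nPart hNH (k : G)) : ℂ) :=
    continuous_subtype_val.comp (hν.comp (hn.comp continuous_subtype_val))
  have h2 : Continuous fun k : isotropy ν => (σ ⟨hPart hNH (k : G),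
      hPart_mem_littleGroup hNH k.2⟩ : V →L[ℂ] V) :=
    hσ.comp ((hh.comp continuous_subtype_val).subtype_mk _)
  refine (h1.smul h2).congr fun k => ?_
  change _ = ((ν _ : ℂ) • (1 : V →L[ℂ] V)) * (σ _ : V →L[ℂ] V)
  rw [smul_mul_assoc, one_mul]
  rfl

variable [IsTopologicalGroup G]

theorem boostingBundle_metric (hNH : Function.Bijective (mulMap N H)) (hν : Continuous ν)
    (hσ : Continuous fun k => (σ k : V →L[ℂ] V)) (hLc : Continuous L)
    (hL : ∀ q, (L q : H ⧸ littleGroup H ν) = q) (q : H ⧸ littleGroup H ν) (v w : V) :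
    (boostingBundle hNH hν hσ hLc hL).metric q v w = inner ℂ v w := rfl

theorem continuous_isotropyPart (hNH : Function.Bijective (mulMap N H))
    (hh : Continuous (hPart hNH)) (hLc : Continuous L)
    (hL : ∀ q, (L q : H ⧸ littleGroup H ν) = q) : Continuous (isotropyPart hNH hL) := by
  have : Continuous fun g => (L (hPart hNH g : H ⧸ littleGroup H ν) : G) :=
    continuous_subtype_val.comp (hLc.comp (QuotientGroup.continuous_mk.comp hh))
  exact (this.inv.mul continuous_id).subtype_mk _

variable [MeasurableSpace G] [BorelSpace G]
  [MeasurableSpace V] [BorelSpace V] [FiniteDimensional ℂ V]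

theorem measurable_covariantExtension (hNH : Function.Bijective (mulMap N H))
    (hn : Continuous (nPart hNH)) (hh : Continuous (hPart hNH)) (hν : Continuous ν)
    (hσ : Continuous fun k => (σ k : V →L[ℂ] V)) (hLc : Continuous L)
    (hL : ∀ q, (L q : H ⧸ littleGroup H ν) = q) {ψ : H ⧸ littleGroup H ν → V}
    (hψ : Measurable ψ) : Measurable (covariantExtension hNH hL σ ψ) := by
  have : ProperSpace V := FiniteDimensional.proper ℂ V
  have : SecondCountableTopology V := secondCountable_of_proper
  -- For a unitary the inverse is the adjoint, so the inverse operator is continuous in g. Joint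
  -- evaluation on G × V is then continuous, and ψ is only required to be Borel.
  have hU : Continuous fun g => star (nuSigma hNH ν σ (isotropyPart hNH hL g) : V →L[ℂ] V) :=
    ((continuous_nuSigma hNH hn hh hν hσ).comp (continuous_isotropyPart hNH hh hLc hL)).star
  have hU' : Continuous fun p : G × V =>
      star (nuSigma hNH ν σ (isotropyPart hNH hL p.1) : V →L[ℂ] V) p.2 :=
    (hU.comp continuous_fst).clm_apply continuous_snd
  have hh' : Measurable (hPart hNH) := hh.measurable
  have hψ' : Measurable fun g => ψ (hPart hNH g : H ⧸ littleGroup H ν) :=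
    hψ.comp (QuotientGroup.measurable_coe.comp hh')
  have h := hU'.measurable.comp (measurable_id.prodMk hψ')
  have he : covariantExtension hNH hL σ ψ = fun g =>
      star (nuSigma hNH ν σ (isotropyPart hNH hL g) : V →L[ℂ] V)
        (ψ (hPart hNH g : H ⧸ littleGroup H ν)) := funext fun g => rfl
  rw [he]
  exact h

/-- Restriction of covariant functions along the section `L`, as a map from the space of the induced
representation to sections of the boosting bundle. -/
noncomputable def restrictSection (hNH : Function.Bijective (mulMap N H)) (hν : Continuous ν)
    (hσ : Continuous fun k => (σ k : V →L[ℂ] V)) (hLc : Continuous L)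
    (hL : ∀ q, (L q : H ⧸ littleGroup H ν) = q) (μ : Measure (H ⧸ littleGroup H ν)) :
    IndPre (nuSigma hNH ν σ) (μ.map (cosetMap H ν)) →ₗᵢ[ℂ]
      (boostingBundle hNH hν hσ hLc hL).L2Pre μ where
  toFun f := HermitianGBundle.L2Pre.mk (fun q => f (L q))
    (f.measurable.comp (continuous_subtype_val.comp hLc).measurable) (by
      have h := f.lintegral_lt_top
      rw [f.covariant.lintegral_section hL f.measurable] at h
      simpa only [HermitianGBundle.ofReal_metric_self
        (boostingBundle_metric hNH hν hσ hLc hL)] using h)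
  map_add' _ _ := HermitianGBundle.L2Pre.ext fun _ => rfl
  map_smul' _ _ := HermitianGBundle.L2Pre.ext fun _ => rfl
  norm_map' f := by
    change √(RCLike.re (∫ q, inner ℂ (f (L q)) (f (L q)) ∂μ))
      = √(RCLike.re (∫ q : G ⧸ isotropy ν, inner ℂ (f q.out) (f q.out) ∂μ.map (cosetMap H ν)))
    rw [integral_map measurable_cosetMap.aemeasurable (f.covariant.measurable_inner f.covariant
      f.measurable f.measurable).aestronglyMeasurable]
    simp_rw [cosetMap_eq_mk hL, f.covariant.inner_out f.covariant]

/-- A section ψ is the restriction of its covariant extension, which is square-integrable because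
its norm along L is that of ψ. -/
theorem surjective_restrictSection (hNH : Function.Bijective (mulMap N H))
    (hn : Continuous (nPart hNH)) (hh : Continuous (hPart hNH)) (hν : Continuous ν)
    (hσ : Continuous fun k => (σ k : V →L[ℂ] V)) (hLc : Continuous L)
    (hL : ∀ q, (L q : H ⧸ littleGroup H ν) = q) (μ : Measure (H ⧸ littleGroup H ν)) :
    Function.Surjective (restrictSection hNH hν hσ hLc hL μ) := by
  intro ψ
  have hm := measurable_covariantExtension hNH hn hh hν hσ hLc hL ψ.measurable
  have hc := isCovariant_covariantExtension (σ := σ) hNH hL ψ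
  refine ⟨IndPre.mk _ hm hc ?_, HermitianGBundle.L2Pre.ext fun q => ?_⟩
  · rw [hc.lintegral_section hL hm]
    simp_rw [covariantExtension_section]
    simpa only [HermitianGBundle.ofReal_metric_self
      (boostingBundle_metric hNH hν hσ hLc hL)] using ψ.lintegral_lt_top
  · exact covariantExtension_section hNH hL ψ q

theorem restrictSection_indPreRep (hNH : Function.Bijective (mulMap N H)) (hν : Continuous ν)
    (hσ : Continuous fun k => (σ k : V →L[ℂ] V)) (hLc : Continuous L)
    (hL : ∀ q, (L q : H ⧸ littleGroup H ν) = q) (μ : Measure (H ⧸ littleGroup H ν))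
    [SMulInvariantMeasure H (H ⧸ littleGroup H ν) μ] (s : G)
    (f : IndPre (nuSigma hNH ν σ) (μ.map (cosetMap H ν))) :
    restrictSection hNH hν hσ hLc hL μ (indPreRep _ (measurePreserving_cosetMap hNH μ) s f)
      = (boostingBundle hNH hν hσ hLc hL).preRep (measurePreserving_baseAction hNH μ) s
          (restrictSection hNH hν hσ hLc hL μ f) := by
  refine HermitianGBundle.L2Pre.ext fun q => ?_
  have h1 : (baseAction hNH ν s)⁻¹ q = (hPart hNH s)⁻¹ • q := by
    rw [Equiv.Perm.inv_eq_iff_eq]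
    exact (smul_inv_smul (hPart hNH s) q).symm
  change f (s⁻¹ * L q) = ((boostingBundle hNH hν hσ hLc hL).act s ((baseAction hNH ν s)⁻¹ q,
    f (L ((baseAction hNH ν s)⁻¹ q)))).2
  rw [f.covariant.inv_mul_section hNH hL s q, h1]
  -- The bundle action twists by the character at the target point, here h • h⁻¹ • q = q, in
  -- agreement with `IsCovariant.inv_mul_section`.
  change _ = (charTwist ν (nPart hNH s) (hPart hNH s • (hPart hNH s)⁻¹ • q) : ℂ) • _
  rw [smul_inv_smul]

/-- The induced representation `Ind νσ` is unitarily equivalent to the representation on the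
sections of the boosting bundle. -/
theorem unitarilyEquivalent_indRep_boosting (hNH : Function.Bijective (mulMap N H))
    (hn : Continuous (nPart hNH)) (hh : Continuous (hPart hNH)) (hν : Continuous ν)
    (hσ : Continuous fun k => (σ k : V →L[ℂ] V)) (hLc : Continuous L)
    (hL : ∀ q, (L q : H ⧸ littleGroup H ν) = q) (μ : Measure (H ⧸ littleGroup H ν))
    [SMulInvariantMeasure H (H ⧸ littleGroup H ν) μ] :
    UnitarilyEquivalent (indRep (nuSigma hNH ν σ) (measurePreserving_cosetMap hNH μ))
      ((boostingBundle hNH hν hσ hLc hL).rep (measurePreserving_baseAction hNH μ)) := by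
  refine ⟨SeparationQuotient.liftIsometryEquiv
    ((SeparationQuotient.mkIsometry _).comp (restrictSection hNH hν hσ hLc hL μ))
    (SeparationQuotient.surjective_mk.comp
      (surjective_restrictSection hNH hn hh hν hσ hLc hL μ)), fun s f => ?_⟩
  obtain ⟨f, rfl⟩ := SeparationQuotient.surjective_mk f
  exact congrArg SeparationQuotient.mk (restrictSection_indPreRep hNH hν hσ hLc hL μ s f)

/-- In the presence of a continuous section the quotient `σ`-algebra of `H / H_ν` is the Borel
`σ`-algebra. -/
theorem borelSpace_quotient_of_section {K : Type*} [Group K] [TopologicalSpace K]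
    [MeasurableSpace K] [BorelSpace K] {Γ : Subgroup K} {L : K ⧸ Γ → K} (hLc : Continuous L)
    (hL : ∀ q, (L q : K ⧸ Γ) = q) : BorelSpace (K ⧸ Γ) := by
  refine ⟨le_antisymm (fun s hs => ?_) OpensMeasurableSpace.borel_le⟩
  -- A set s in the quotient σ-algebra has Borel preimage in K; pulling this preimage back along the
  -- continuous L returns s, because L is a section.
  have h1 : MeasurableSet ((QuotientGroup.mk : K → K ⧸ Γ) ⁻¹' s) := hs
  have h2 := @Continuous.measurable _ _ _ (borel (K ⧸ Γ)) (@BorelSpace.opensMeasurable _ _ (borel _)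
    (@BorelSpace.mk _ _ (borel _) rfl)) _ _ _ _ hLc
  have h3 := h2 h1
  rwa [← Set.preimage_comp, show (QuotientGroup.mk : K → K ⧸ Γ) ∘ L = id from funext hL,
    Set.preimage_id] at h3

end InducedBoosting

/-! ### The main theorem -/

theorem theorem5p5
    {EG EN EH EM : Type*}
    [NormedAddCommGroup EG] [NormedSpace ℝ EG] [FiniteDimensional ℝ EG]
    [NormedAddCommGroup EN] [NormedSpace ℝ EN] [FiniteDimensional ℝ EN]
    [NormedAddCommGroup EH] [NormedSpace ℝ EH] [FiniteDimensional ℝ EH]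
    [NormedAddCommGroup EM] [NormedSpace ℝ EM] [FiniteDimensional ℝ EM]
    -- the Lie group `G = N ⋉ H`
    {G : Type*} [Group G] [TopologicalSpace G] [IsTopologicalGroup G] [T2Space G]
    [SecondCountableTopology G] [ChartedSpace EG G] [LieGroup 𝓘(ℝ, EG) ∞ G]
    [MeasurableSpace G] [BorelSpace G]
    (N H : Subgroup G) [N.Normal]
    [ChartedSpace EN N] [LieGroup 𝓘(ℝ, EN) ∞ N] [ChartedSpace EH H] [LieGroup 𝓘(ℝ, EH) ∞ H]
    (hG : IsLieSemidirect (EG := EG) (EN := EN) (EH := EH) N H)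
    -- the character `ν` of `N`
    (ν : N →* Circle) (hν : ContMDiff 𝓘(ℝ, EN) (𝓡 1) ∞ ν)
    -- the unitary representation `σ` of the little group and its extension `Φ` to `H`
    {V : Type*} [NormedAddCommGroup V] [InnerProductSpace ℂ V] [CompleteSpace V]
    [FiniteDimensional ℂ V] [MeasurableSpace V] [BorelSpace V]
    (σ : littleGroup H ν →* unitary (V →L[ℂ] V)) (hσ : Continuous fun k => (σ k : V →L[ℂ] V))
    (Φ : H →* (V →L[ℂ] V)ˣ)
    (hΦ : ContMDiff 𝓘(ℝ, EH) 𝓘(ℝ, V →L[ℂ] V) ∞ fun x => (Φ x : V →L[ℂ] V))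
    (hΦσ : ∀ k : littleGroup H ν, (Φ k : V →L[ℂ] V) = σ k)
    -- the smooth structure of the homogeneous space `H / H_ν`: the projection is a submersion
    [ChartedSpace EM (H ⧸ littleGroup H ν)] [IsManifold 𝓘(ℝ, EM) ∞ (H ⧸ littleGroup H ν)]
    (hπ : Manifold.IsSubmersion 𝓘(ℝ, EH) 𝓘(ℝ, EM) ∞
      (QuotientGroup.mk : H → H ⧸ littleGroup H ν))
    -- the global section `L` and the invariant measure `μ`
    (L : H ⧸ littleGroup H ν → H) (hLs : ContMDiff 𝓘(ℝ, EM) 𝓘(ℝ, EH) ∞ L)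
    (hL : ∀ q, (L q : H ⧸ littleGroup H ν) = q)
    (μ : Measure (H ⧸ littleGroup H ν)) [SMulInvariantMeasure H (H ⧸ littleGroup H ν) μ] :
    let E := perceptionBundle hG.bijective hν.continuous hΦ.continuous hΦσ
    let EL := boostingBundle hG.bijective hν.continuous hσ hLs.continuous hL
    let Ind := indRep (nuSigma hG.bijective ν σ) (measurePreserving_cosetMap hG.bijective μ)
    let U := E.rep (measurePreserving_baseAction hG.bijective μ)
    let UL := EL.rep (measurePreserving_baseAction hG.bijective μ)
    -- both are (smooth) Hermitian `G`-bundles, and `α` is an isomorphism between them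
    E.IsSmooth (EG := EG) (EM := EM) ∧ EL.IsSmooth (EG := EG) (EM := EM) ∧
    E.IsIso EL (boostMap Φ L) (EM := EM) ∧
    -- `Ind ≅ U ≅ U_L`
    UnitarilyEquivalent Ind U ∧ UnitarilyEquivalent U UL ∧
    -- composition with `α` is a unitary equivalence of `U` and `U_L`
    (∃ T : E.L2Section μ ≃ₗᵢ[ℂ] EL.L2Section μ,
      (∀ φ : E.L2Pre μ, ∃ ψ : EL.L2Pre μ,
        (∀ x, (x, ψ x) = boostMap Φ L (x, φ x)) ∧ T (E.toL2 μ φ) = EL.toL2 μ ψ) ∧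
      ∀ s f, T (U s f) = UL s (T f)) ∧
    -- the `L²`-section space of the boosting bundle is `L²(H/H_ν; μ) ⊗ V`
    (∃ S : (Lp ℂ 2 μ ⊗[ℂ] V) ≃ₗᵢ[ℂ] EL.L2Section μ,
      ∀ (f : Lp ℂ 2 μ) (v : V), ∃ ψ : EL.L2Pre μ,
        (∀ᵐ x ∂μ, ψ x = f x • v) ∧ S (f ⊗ₜ[ℂ] v) = EL.toL2 μ ψ) ∧
    -- the representation spaces are Hilbert spaces, and the representations are strongly
    -- continuous if `μ` is a Radon measure
    (CompleteSpace (IndSpace (nuSigma hG.bijective ν σ) (μ.map (cosetMap H ν))) ∧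
      CompleteSpace (E.L2Section μ) ∧ CompleteSpace (EL.L2Section μ)) ∧
    (μ.Regular → StronglyContinuous Ind ∧ StronglyContinuous U ∧ StronglyContinuous UL) := by
  intro E EL Ind U UL
  have hπs : ContMDiff 𝓘(ℝ, EH) 𝓘(ℝ, EM) ∞ (QuotientGroup.mk : H → H ⧸ littleGroup H ν) :=
    hπ.contMDiff
  have hLc := hLs.continuous
  have hEL : EL.IsSmooth (EG := EG) (EM := EM) :=
    isSmooth_boostingBundle hG hν hσ hΦ hΦσ hπs hLs hL
  have hiso : E.IsIso EL (boostMap Φ L) (EM := EM) := isIso_boostMap hG hν hσ hΦ hΦσ hLs hL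
  have hmet : ∀ q v w, EL.metric q v w = inner ℂ v w :=
    boostingBundle_metric hG.bijective hν.continuous hσ hLc hL
  have hIndUL : UnitarilyEquivalent Ind UL :=
    unitarilyEquivalent_indRep_boosting hG.bijective hG.contMDiff_parts.1.continuous
      hG.contMDiff_parts.2.continuous hν.continuous hσ hLc hL μ
  obtain ⟨T, hT, hTU⟩ := hiso.exists_unitaryEquiv (measurePreserving_baseAction hG.bijective μ)
  have hUUL : UnitarilyEquivalent U UL := ⟨T, hTU⟩
  have hcEL : CompleteSpace (EL.L2Section μ) := HermitianGBundle.completeSpace_l2Section μ hmet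
  refine ⟨isSmooth_perceptionBundle hG hν hΦ hΦσ hπs hLs hL, hEL, hiso,
    hIndUL.trans hUUL.symm, hUUL, ⟨T, hT, hTU⟩, HermitianGBundle.exists_tensorEquiv μ hmet,
    ⟨hIndUL.completeSpace, hUUL.completeSpace, hcEL⟩, fun hreg => ?_⟩
  have hUL : StronglyContinuous UL := by
    -- Topological input for the strong continuity criterion: the quotient is Hausdorff because L
    -- injects it continuously into H, and locally compact because it is modelled on a
    -- finite-dimensional space.
    have : BorelSpace (H ⧸ littleGroup H ν) := borelSpace_quotient_of_section hLc hL
    have hemb : Function.LeftInverse (QuotientGroup.mk : H → H ⧸ littleGroup H ν) L := hL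
    have : T2Space (H ⧸ littleGroup H ν) := T2Space.of_injective_continuous hemb.injective hLc
    have : LocallyCompactSpace (H ⧸ littleGroup H ν) := ChartedSpace.locallyCompactSpace EM _
    exact HermitianGBundle.stronglyContinuous_rep hmet _ hEL.base.continuous hEL.act.continuous
  exact ⟨hIndUL.stronglyContinuous hUL, hUUL.stronglyContinuous hUL, hUL⟩
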